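/- Let $k$ be a field of prime characteristic $p$, $S=k[x_1,\dots,x_m]$, and let $f=[2]+[1]$, where $[2]=c_2x^{u}$ and $[1]=c_1x^{v}$ with $c_1,c_2\in k\setminus\{0\}$ and $u,v\in\mathbb N^m$. Put $\Delta_i=v_i-u_i$, and let the variables be numbered so that $\Delta_1\le\dots\le\Delta_m$. Let $r,s,t$ be the numbers of $i$ with $\Delta_i<0$, $\Delta_i=0$, $\Delta_i>0$, and suppose $r\ge 1$ (this holds whenever $[2]$ is the larger of two distinct terms in the degree lexicographic order). Write $N_i=x_{r+1-i}$ $(1\le i\le r)$, $Z_i=x_{r+s+1-i}$ $(1\le i\le s)$, $P_q=x_{r+s+q}$ $(1\le q\le t)$. For a variable $Y=x_i$ let $\Delta_Y=\Delta_i$, $Y_{\max}=\max(u_i,v_i)$, $Y_{\min}=\min(u_i,v_i)$; we write $N_{i,\max}$ for $(N_i)_{\max}$, and so on. Fix $n$, put $Q=p^n$ and define the following integers. **Negative difference variables.** For $1\le i\le r$ let $a_i=-\Delta_{N_i}$, $b_i=N_{i,\min}$, and $Q-1=a_iM_{a_i}+r_{a_i}$ with $0\le r_{a_i}<a_i$.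 If $b_i\ge a_i$, let $y_{a_i}$ be the least positive multiple of $a_i$ that is $\ge b_i-r_{a_i}$, and $q_{a_i}=y_{a_i}/a_i$. Let $p_{a_i}=0$ if $b_i<a_i$ and $r_{a_i}\ge b_i$; $p_{a_i}=1$ if $b_i<a_i$ and $r_{a_i}<b_i$; $p_{a_i}=q_{a_i}$ if $b_i\ge a_i$. Let $E_i=r_{a_i}-b_i$, $\;r_{a_i}-b_i+a_i$, $\;y_{a_i}-(b_i-r_{a_i})$ in these three cases respectively. Let $\tilde k_{i}$ be the smallest positive integer $\ge (Q-N_{i,\max}-1-E_i)/a_i$, and $$D_{a_i,a_r}=1+E_i+a_i(M_{a_i}-p_{a_i}-M_{a_r}+p_{a_r}),\quad a_i'=Q-N_{i,\max}-\bigl(1+E_i+a_i(\tilde k_i-1)\bigr),\quad \tilde X_i=M_{a_r}-p_{a_r}-M_{a_i}+p_{a_i}+\tilde k_i .$$ **The function $\Phi$.** For $M\in\mathbb Z$ and $1\le q\le t$ let $\mu_q=\min\{Q-P_{q,\min},\,M\Delta_{P_q}\}$, $d_q=\min\{P_{q,\max}-1,\,Q-\mu_q-1\}-P_{q,\min}+1$,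 $h_q=\max\{Q-\mu_q-P_{q,\max},0\}$ and $C_q=Q^{t-q+1}$. Put $A_{t+1}=0$, $C_{t+1}=1$, $D_{t+1}=1$, $\tilde D_{t+1}=0$, and, downwards in $q$, $$A_q=(Q-P_{q,\min})A_{q+1}+P_{q,\min}C_{q+1},\qquad D_q=\mu_qA_{q+1}+(Q-P_{q,\min}-\mu_q)D_{q+1}+P_{q,\min}C_{q+1},$$ $$\tilde D_q=\mu_qA_{q+1}+\epsilon_q\,(h_q\tilde D_{q+1}+d_qD_{q+1})+P_{q,\min}C_{q+1},$$ where $\epsilon_q=1$ if $\mu_q<Q-P_{q,\min}$ and $\epsilon_q=0$ otherwise. Let $\mathfrak S_{M,0}=\tilde D_1$ (so $\mathfrak S_{M,0}=0$ if $t=0$), $\mathfrak S_{M,j}=(Q-Z_{j,\min})\mathfrak S_{M,j-1}+Z_{j,\min}Q^{t+j-1}$ for $1\le j\le s$, and $\Phi_M=\mathfrak S_{M,s}$. **The numbers $G$.** Let $G_{P_t}=0$ and $G_{P_{q}}=(Q-P_{q+1,\max})G_{P_{q+1}}+P_{q+1,\max}Q^{t-q-1}$ for $0\le q<t$; let $G_{Z_1}=G_{P_0}$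 and $G_{Z_{l+1}}=(Q-Z_{l,\max})G_{Z_l}+Z_{l,\max}Q^{t+l-1}$ for $1\le l\le s$; let $G_{N_1}=G_{Z_{s+1}}$ and $G_{N_{i+1}}=(Q-N_{i,\min})G_{N_i}+N_{i,\min}Q^{t+s+i-1}$ for $1\le i<r$. **The integrals.** Let $\int_j^{(N_1)}=\Phi_{M_{a_r}-p_{a_r}-j}$. For $1\le i<r$ put $K_{i}=(N_{i,\max}-N_{i,\min})G_{N_{i}}+N_{i,\min}Q^{s+t+i-1}$ and let $$\int_j^{(N_{i+1})}=\begin{cases}(D_{a_i,a_r}+ja_i)\int_j^{(N_i)}+a_i\sum_{j<l<\tilde X_i}\int_l^{(N_i)}+a_i'\int_{\tilde X_i}^{(N_i)}+K_i,& j<\tilde X_i,\\ (Q-N_{i,\max})\int_j^{(N_i)}+K_i,& j\ge\tilde X_i.\end{cases}$$ Define $K_r$ by the same expression as $K_i$, with $i=r$. **(1) The formula.** Suppose that $u_i<Q$ and $v_i\le Q$ for all $i$, and that $M_{a_r}-p_{a_r}\le M_{a_i}-p_{a_i}$ for $1\le i\le r$. Then $S/((x_1^{Q},\dots,x_m^{Q})+(f))$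 has finite length, and $$l\bigl(S/((x_1^{p^n},\dots,x_m^{p^n})+(f))\bigr)=D_{a_r,a_r}\int_0^{(N_r)}+a_r\sum_{0<j<\tilde X_r}\int_j^{(N_r)}+a_r'\int_{\tilde X_r}^{(N_r)}+K_r .$$ **(2) The expanded form.** Suppose in addition that $1\le\tilde X_1\le\tilde X_2\le\dots\le\tilde X_r$. Let $F^{(1)}_j=1$, $F^{(2)}_j=2j-1$, $F_j^{(l)}=\sum_{i=1}^{j-1}F_i^{(l-1)}+jF_j^{(l-1)}$ for $l\ge3$, and $H_l^{(i)}=\sum_{T}\prod_{c\in T}a_c\prod_{c\in\{i,\dots,r\}\setminus T}D_{a_c,a_r}$ over all $T\subseteq\{i,\dots,r\}$ with $|T|=l$. Let $C_j^{(N_r)}$ be the coefficient of $\int_j^{(N_r)}$ in (1), that is $D_{a_r,a_r}$, $a_r$, $a_r'$ for $j=0$, $0<j<\tilde X_r$, $j=\tilde X_r$, respectively. For $1\le i<r$ let $C_0^{(N_i)}=\prod_{c=i}^rD_{a_c,a_r}$; let $C_j^{(N_i)}=\sum_{l=1}^{r-i+1}F_j^{(l)}H_l^{(i)}$ for $1\le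 j<\tilde X_i$; let $C_{\tilde X_i}^{(N_i)}=a_i'\sum_{j=0}^{\tilde X_i-1}C_j^{(N_{i+1})}+(Q-N_{i,\max})C_{\tilde X_i}^{(N_{i+1})}$; and let $C_j^{(N_i)}=(Q-N_{i,\max})C_j^{(N_{i+1})}$ for $\tilde X_i<j\le\tilde X_r$. If $r=1$, put $C^{(N_2)}_0=1$ and $C_j^{(N_2)}=0$ for $j>0$. Then the length in (1) also equals $$\sum_{j=0}^{\tilde X_1-1}C_j^{(N_1)}\int_j^{(N_1)}+\Bigl[a_1'\sum_{j=0}^{\tilde X_1-1}C_j^{(N_2)}+(Q-N_{1,\max})C^{(N_2)}_{\tilde X_1}\Bigr]\int_{\tilde X_1}^{(N_1)}+(Q-N_{1,\max})\sum_{j=\tilde X_1+1}^{\tilde X_r}C_j^{(N_2)}\int_j^{(N_1)}+K_r$$ $$+\sum_{c=1}^{r-1}K_{r-c}\Bigl[C_0^{(N_{r-c+1})}+\sum_{l=1}^{c}H_l^{(r-c+1)}\sum_{j=1}^{\tilde X_{r-c+1}-1}F_j^{(l)}+\sum_{j=\tilde X_{r-c+1}}^{\tilde X_r}C_j^{(N_{r-c+1})}\Bigr].$$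 **(3) Closed form of $\Phi$ in the simple case.** Let $n\ge 0$, $t\ge1$, $M\in\mathbb Z$, and suppose $Q-P_{q,\max}\le\mu_q<Q-P_{q,\min}$ for $1\le q\le t$. For $2\le l\le t$ let $E_l$ be the sum of all products over $l$ distinct indices $q$ of factors $\mu_q$ or $P_{q,\min}$ in which both kinds of factors occur. Then $$\Phi_M=\Bigl[\prod_{q=1}^t(Q-M\Delta_{P_q})+\sum_{l=2}^t(-1)^lE_lQ^{t-l}\Bigr]\prod_{i=1}^s(Q-Z_{i,\min})+\sum_{c=1}^s(-1)^{c+1}Q^{t+s-c}\sum_{i_1<\dots<i_c}Z_{i_1,\min}\cdots Z_{i_c,\min}.$$ **(4) Range of validity.** If $b_i\le b_r$ for all $i$ with $a_i=a_r$ (which can always be achieved by renumbering variables with equal $\Delta_i$), then the hypotheses of (1) and (2) hold for all sufficiently large $n$. -/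

import Mathlib

/-!
Notation for the Hilbert–Kunz function of a binomial hypersurface `f = [2] + [1]` in
`k[x_1, …, x_m]`.  In all definitions below `Q` stands for `p ^ n`, and the indices
`i`, `l`, `q` of the variables `N_i`, `Z_l`, `P_q` start at `1`.
-/

noncomputable section

namespace BinomialHK

/-- The exponent vectors of the two terms `[2]` and `[1]` of a binomial. -/
structure Exponents (m : ℕ) where
  /-- exponents of the term `[2]` -/
  e₂ : Fin m → ℕ
  /-- exponents of the term `[1]` -/
  e₁ : Fin m → ℕ

/-- The binomial `c₂ x^{e₂} + c₁ x^{e₁}`. -/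
def Exponents.poly {m : ℕ} (B : Exponents m) {k : Type*} [Field k] (c₂ c₁ : k) :
    MvPolynomial (Fin m) k :=
  MvPolynomial.monomial (Finsupp.equivFunOnFinite.symm B.e₂) c₂ +
    MvPolynomial.monomial (Finsupp.equivFunOnFinite.symm B.e₁) c₁

/-- The Frobenius power `(x_1^Q, …, x_m^Q)` of the ideal `(x_1, …, x_m)`. -/
def frobeniusPower (m : ℕ) (k : Type*) [Field k] (Q : ℕ) : Ideal (MvPolynomial (Fin m) k) :=
  Ideal.span (Set.range fun i : Fin m => (MvPolynomial.X i : MvPolynomial (Fin m) k) ^ Q)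

/-- The length of `S / ((x_1^Q, …, x_m^Q) + (f))`, where `S = k[x_1, …, x_m]`. -/
def hkLength {m : ℕ} {k : Type*} [Field k] (f : MvPolynomial (Fin m) k) (Q : ℕ) : ℕ∞ :=
  Module.length (MvPolynomial (Fin m) k)
    (MvPolynomial (Fin m) k ⧸ (frobeniusPower m k Q ⊔ Ideal.span {f}))

namespace Exponents

variable {m : ℕ} (B : Exponents m) (Q : ℕ)

/-! ### The variables -/

/-- `Δ_i`: the exponent of `x_i` in `[1]` minus its exponent in `[2]`. -/
def Δ (i : Fin m) : ℤ := (B.e₁ i : ℤ) - B.e₂ i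

/-- The number of negative difference variables. -/
def r : ℕ := (Finset.univ.filter fun i => B.Δ i < 0).card

/-- The number of zero difference variables. -/
def s : ℕ := (Finset.univ.filter fun i => B.Δ i = 0).card

/-- The number of positive difference variables. -/
def t : ℕ := m - (B.r + B.s)

/-- The larger exponent in `f` of the variable at position `j` (positions start at `0`). -/
def expMax (j : ℕ) : ℤ := if h : j < m then max (B.e₂ ⟨j, h⟩) (B.e₁ ⟨j, h⟩) else 0

/-- The smaller exponent in `f` of the variable at position `j` (positions start at `0`). -/
def expMin (j : ℕ) : ℤ := if h : j < m then min (B.e₂ ⟨j, h⟩) (B.e₁ ⟨j, h⟩) else 0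

/-- The difference of the variable at position `j` (positions start at `0`). -/
def diff (j : ℕ) : ℤ := if h : j < m then B.Δ ⟨j, h⟩ else 0

/-- `N_i` is the variable `x_{r+1-i}`, which stands at position `r - i`. -/
def NMax (i : ℕ) : ℤ := B.expMax (B.r - i)

def NMin (i : ℕ) : ℤ := B.expMin (B.r - i)

/-- `Z_i` is the variable `x_{r+s+1-i}`, which stands at position `r + s - i`. -/
def ZMax (i : ℕ) : ℤ := B.expMax (B.r + B.s - i)

def ZMin (i : ℕ) : ℤ := B.expMin (B.r + B.s - i)

/-- `P_q` is the variable `x_{r+s+q}`, which stands at position `r + s + q - 1`. -/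
def PMax (q : ℕ) : ℤ := B.expMax (B.r + B.s + q - 1)

def PMin (q : ℕ) : ℤ := B.expMin (B.r + B.s + q - 1)

def ΔP (q : ℕ) : ℤ := B.diff (B.r + B.s + q - 1)

/-- `a_i = -Δ_{N_i}` -/
def a (i : ℕ) : ℤ := -B.diff (B.r - i)

/-- `b_i = N_{i,min}` -/
def b (i : ℕ) : ℤ := B.NMin i

/-! ### The numbers attached to the negative difference variables -/

/-- `M_{a_i,n}`, the quotient of `p ^ n - 1` by `a_i` -/
def Mq (i : ℕ) : ℤ := ((Q : ℤ) - 1) / B.a i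

/-- `r_{a_i,n}`, the remainder of `p ^ n - 1` by `a_i` -/
def rem (i : ℕ) : ℤ := ((Q : ℤ) - 1) % B.a i

/-- `y_{a_i}`: the least positive integer `≥ b_i - r_{a_i,n}` that is divisible by `a_i`. -/
def y (i : ℕ) : ℤ :=
  ((sInf {z : ℕ | 0 < z ∧ B.b i - B.rem Q i ≤ z ∧ B.a i ∣ z} : ℕ) : ℤ)

/-- `q_{a_i}`, with `y_{a_i} = a_i q_{a_i}` -/
def qa (i : ℕ) : ℤ := B.y Q i / B.a i

/-- `p_{a_i}` -/
def pa (i : ℕ) : ℤ :=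
  if B.b i < B.a i then (if B.b i ≤ B.rem Q i then 0 else 1) else B.qa Q i

/-- `E_{a_i,b_i}` -/
def E (i : ℕ) : ℤ :=
  if B.pa Q i = 0 then B.rem Q i - B.b i
  else if B.pa Q i = 1 then (B.rem Q i - B.b i) + B.a i
  else B.y Q i - (B.b i - B.rem Q i)

/-- The smallest positive integer `≥ β`. -/
def leastPos (β : ℚ) : ℤ := max 1 ⌈β⌉

/-- `k̃_{N_i,last}` -/
def kLast (i : ℕ) : ℤ :=
  leastPos ((((Q : ℤ) - B.NMax i - 1 - B.E Q i : ℤ) : ℚ) / (B.a i : ℚ))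

/-- `D_{a_i,a_r}` -/
def Da (i : ℕ) : ℤ :=
  (1 + B.E Q i) + B.a i * (B.Mq Q i - B.pa Q i - B.Mq Q B.r + B.pa Q B.r)

/-- `a_i'` -/
def a' (i : ℕ) : ℤ := Q - B.NMax i - (1 + B.E Q i + B.a i * (B.kLast Q i - 1))

/-- `X̃_{N_i,last}` -/
def Xlast (i : ℕ) : ℤ := B.Mq Q B.r - B.pa Q B.r - B.Mq Q i + B.pa Q i + B.kLast Q i

/-! ### The function `Φ` -/

/-- `Min^c_{P_q,M}` -/
def minc (M : ℤ) (q : ℕ) : ℤ := min (Q - B.PMin q) (M * B.ΔP q)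

/-- `s_{P_q,M}` -/
def sP (M : ℤ) (q : ℕ) : ℤ := min (B.PMax q - 1) (Q - B.minc Q M q - 1)

/-- `d_{P_q,M}` -/
def dP (M : ℤ) (q : ℕ) : ℤ := B.sP Q M q - B.PMin q + 1

/-- `h_{P_q,M}` -/
def hP (M : ℤ) (q : ℕ) : ℤ :=
  if B.PMax q < Q - B.minc Q M q then (Q - B.minc Q M q) - B.PMax q else 0

/-- `C_q = p^{(t-q+1)n}` -/
def Cq (q : ℕ) : ℤ := (Q : ℤ) ^ (B.t + 1 - q)

/-- `A_q`, with `A_{t+1} = 0` -/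
def Aq (q : ℕ) : ℤ :=
  if B.t < q then 0
  else (Q - B.PMin q) * Aq (q + 1) + B.PMin q * B.Cq Q (q + 1)
termination_by B.t + 1 - q

/-- `D_{q,M}`, with `D_{t+1,M} = 1` -/
def Dq (M : ℤ) (q : ℕ) : ℤ :=
  if B.t < q then 1
  else B.minc Q M q * B.Aq Q (q + 1) + (Q - B.PMin q - B.minc Q M q) * Dq M (q + 1)
    + B.PMin q * B.Cq Q (q + 1)
termination_by B.t + 1 - q

/-- `D̃_{q,M}`, with `D̃_{t+1,M} = 0` -/
def Dtilde (M : ℤ) (q : ℕ) : ℤ :=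
  if B.t < q then 0
  else if B.minc Q M q < Q - B.PMin q then
    B.minc Q M q * B.Aq Q (q + 1) + B.hP Q M q * Dtilde M (q + 1)
      + B.dP Q M q * B.Dq Q M (q + 1) + B.PMin q * B.Cq Q (q + 1)
  else B.minc Q M q * B.Aq Q (q + 1) + B.PMin q * B.Cq Q (q + 1)
termination_by B.t + 1 - q

/-- `B_{P_1,M}` -/
def BP (M : ℤ) : ℤ :=
  if B.minc Q M 1 < Q - B.PMin 1 then
    B.hP Q M 1 * B.Dtilde Q M 2 + B.dP Q M 1 * B.Dq Q M 2
  else 0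

/-- `𝔖_{M,j}`; if there are no positive difference variables, then `𝔖_{M,0} = 0`. -/
def frakS (M : ℤ) : ℕ → ℤ
  | 0 => if B.t = 0 then 0
      else B.Aq Q 2 * B.minc Q M 1 + B.BP Q M + B.Cq Q 2 * B.PMin 1
  | j + 1 => frakS M j * (Q - B.ZMin (j + 1)) + (Q : ℤ) ^ (B.t + j) * B.ZMin (j + 1)

/-- `Φ_M = 𝔖_{M,s}` -/
def Φ (M : ℤ) : ℤ := B.frakS Q M B.s

/-! ### The numbers `G` -/

/-- `G_{P_q}`.  The value `G_{P_t} = 0` gives `G_{P_{t-1}} = P_{t,max}`. -/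
def GP (q : ℕ) : ℤ :=
  if B.t ≤ q then 0
  else (Q - B.PMax (q + 1)) * GP (q + 1) + B.PMax (q + 1) * (Q : ℤ) ^ (B.t - q - 1)
termination_by B.t - q

/-- `G_{Z_l}` for `l ≥ 1`.  The value at `l = 1` is
`(p^n - P_{1,max}) G_{P_1} + P_{1,max} p^{n(t-1)}` (and `0` if `t = 0`), and the value at
`l = s + 1` is the number `G_{N_1}`. -/
def GZ : ℕ → ℤ
  | 0 => 0
  | 1 => B.GP Q 0
  | l + 2 => (Q - B.ZMax (l + 1)) * GZ (l + 1) + B.ZMax (l + 1) * (Q : ℤ) ^ (B.t + l)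

/-- `G_{N_i}` for `i ≥ 1` -/
def GN : ℕ → ℤ
  | 0 => 0
  | 1 => B.GZ Q (B.s + 1)
  | i + 2 => (Q - B.NMin (i + 1)) * GN (i + 1) + B.NMin (i + 1) * (Q : ℤ) ^ (B.t + B.s + i)

/-! ### The iterative formula -/

/-- `∫_j^{(N_i)}` for `i ≥ 1` -/
def integral : ℕ → ℤ → ℤ
  | 0, _ => 0
  | 1, j => B.Φ Q (B.Mq Q B.r - B.pa Q B.r - j)
  | i + 2, j =>
    if j < B.Xlast Q (i + 1) then
      (B.Da Q (i + 1) + j * B.a (i + 1)) * integral (i + 1) j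
        + ∑ l ∈ Finset.Ioo j (B.Xlast Q (i + 1)), B.a (i + 1) * integral (i + 1) l
        + B.a' Q (i + 1) * integral (i + 1) (B.Xlast Q (i + 1))
        + (B.NMax (i + 1) - B.NMin (i + 1)) * B.GN Q (i + 1)
        + B.NMin (i + 1) * (Q : ℤ) ^ (B.s + B.t + i)
    else
      (Q - B.NMax (i + 1)) * integral (i + 1) j
        + (B.NMax (i + 1) - B.NMin (i + 1)) * B.GN Q (i + 1)
        + B.NMin (i + 1) * (Q : ℤ) ^ (B.s + B.t + i)

/-- The iterative formula for the Hilbert–Kunz function. -/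
def hkFormula : ℤ :=
  B.Da Q B.r * B.integral Q B.r 0
    + ∑ j ∈ Finset.Ioo 0 (B.Xlast Q B.r), B.a B.r * B.integral Q B.r j
    + B.a' Q B.r * B.integral Q B.r (B.Xlast Q B.r)
    + (B.NMax B.r - B.NMin B.r) * B.GN Q B.r
    + B.NMin B.r * (Q : ℤ) ^ (B.s + B.t + B.r - 1)

/-! ### The expanded formula -/

/-- `F_j^{(l)}` for `l ≥ 1` -/
def F : ℕ → ℤ → ℤ
  | 0, _ => 0
  | 1, _ => 1
  | 2, j => 2 * j - 1
  | l + 3, j => (∑ i ∈ Finset.Icc 1 (j - 1), F (l + 2) i) + j * F (l + 2) j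

/-- `H_l^{(i)}`: the sum of the products that contain, for every index `k` in `{i, …, r}`,
one of the factors `a_k` and `D_{a_k,a_r}`, the first one for exactly `l` indices. -/
def H (l i : ℕ) : ℤ :=
  ∑ T ∈ (Finset.Icc i B.r).powersetCard l,
    (∏ k ∈ T, B.a k) * ∏ k ∈ Finset.Icc i B.r \ T, B.Da Q k

/-- `C_j^{(N_i)}`.  For `i = r` these are the coefficients of `∫_j^{(N_r)}` in `hkFormula`;
for `i = r + 1` the values are those of an empty product, which makes sense of `C_j^{(N_2)}`
if `r = 1`. -/
def C (i : ℕ) (j : ℤ) : ℤ :=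
  if B.r < i then (if j = 0 then 1 else 0)
  else if i = B.r then
    (if j = 0 then B.Da Q B.r
      else if j < B.Xlast Q B.r then B.a B.r
      else if j = B.Xlast Q B.r then B.a' Q B.r
      else 0)
  else if j = 0 then ∏ k ∈ Finset.Icc i B.r, B.Da Q k
  else if j < B.Xlast Q i then ∑ l ∈ Finset.Icc 1 (B.r - i + 1), F l j * B.H Q l i
  else if j = B.Xlast Q i then
    B.a' Q i * (∑ j' ∈ Finset.Ico 0 (B.Xlast Q i), C (i + 1) j')
      + (Q - B.NMax i) * C (i + 1) (B.Xlast Q i)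
  else (Q - B.NMax i) * C (i + 1) j
termination_by B.r + 1 - i

/-- The expanded form of the formula for the Hilbert–Kunz function. -/
def hkExpanded : ℤ :=
  (∑ j ∈ Finset.Ico 0 (B.Xlast Q 1), B.C Q 1 j * B.integral Q 1 j)
    + (B.a' Q 1 * (∑ j ∈ Finset.Ico 0 (B.Xlast Q 1), B.C Q 2 j)
        + (Q - B.NMax 1) * B.C Q 2 (B.Xlast Q 1)) * B.integral Q 1 (B.Xlast Q 1)
    + (Q - B.NMax 1) *
        (∑ j ∈ Finset.Icc (B.Xlast Q 1 + 1) (B.Xlast Q B.r), B.C Q 2 j * B.integral Q 1 j)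
    + (B.NMax B.r - B.NMin B.r) * B.GN Q B.r
    + B.NMin B.r * (Q : ℤ) ^ (B.s + B.t + B.r - 1)
    + ∑ c ∈ Finset.Icc 1 (B.r - 1),
        ((B.NMax (B.r - c) - B.NMin (B.r - c)) * B.GN Q (B.r - c)
            + B.NMin (B.r - c) * (Q : ℤ) ^ (B.s + B.t + B.r - c - 1)) *
          (B.C Q (B.r - c + 1) 0
            + (∑ l ∈ Finset.Icc 1 c, B.H Q l (B.r - c + 1) *
                ∑ j ∈ Finset.Icc 1 (B.Xlast Q (B.r - c + 1) - 1), F l j)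
            + ∑ j ∈ Finset.Icc (B.Xlast Q (B.r - c + 1)) (B.Xlast Q B.r),
                B.C Q (B.r - c + 1) j)

/-! ### The closed form of `Φ` in the simple case -/

/-- `E_l`: the sum of the products over `l` distinct indices of factors `Min^c_{P_q,M}` or
`P_{q,min}`, where both kinds of factors occur. -/
def mixedSum (M : ℤ) (l : ℕ) : ℤ :=
  ∑ T ∈ (Finset.Icc 1 B.t).powersetCard l,
    ∑ U ∈ T.powerset.filter (fun U => U ≠ ∅ ∧ U ≠ T),
      (∏ q ∈ U, B.minc Q M q) * ∏ q ∈ T \ U, B.PMin q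

/-- The closed form of `Φ_M`. -/
def ΦClosed (M : ℤ) : ℤ :=
  ((∏ q ∈ Finset.Icc 1 B.t, ((Q : ℤ) - M * B.ΔP q))
      + ∑ l ∈ Finset.Icc 2 B.t, (-1) ^ l * B.mixedSum Q M l * (Q : ℤ) ^ (B.t - l)) *
    (∏ i ∈ Finset.Icc 1 B.s, ((Q : ℤ) - B.ZMin i))
  + ∑ c ∈ Finset.Icc 1 B.s, (-1) ^ (c + 1) * (Q : ℤ) ^ (B.t + B.s - c) *
      ∑ T ∈ (Finset.Icc 1 B.s).powersetCard c, ∏ i ∈ T, B.ZMin i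

/-- The simple case: `p^n - P_{q,max} ≤ Min^c_{P_q,M} < p^n - P_{q,min}` for all `q`. -/
def Simple (M : ℤ) : Prop :=
  ∀ q, 1 ≤ q → q ≤ B.t →
    (Q : ℤ) - B.PMax q ≤ B.minc Q M q ∧ B.minc Q M q < Q - B.PMin q

/-! ### The range of `p ^ n` in which the formulas are meant -/

/-- The term `[2]` divides some monomial with all exponents `< Q`, no exponent of `[1]` exceeds
`Q`, and `M_{a_r,n} - p_{a_r}` is the least of the numbers `M_{a_i,n} - p_{a_i}`. -/
def Admissible : Prop :=
  (∀ i, B.e₂ i < Q) ∧ (∀ i, B.e₁ i ≤ Q) ∧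
    ∀ i, 1 ≤ i → i ≤ B.r → B.Mq Q B.r - B.pa Q B.r ≤ B.Mq Q i - B.pa Q i

/-- `1 ≤ X̃_{N_1,last} ≤ X̃_{N_2,last} ≤ … ≤ X̃_{N_r,last}` -/
def XOrdered : Prop :=
  1 ≤ B.Xlast Q 1 ∧ ∀ i, 1 ≤ i → i < B.r → B.Xlast Q i ≤ B.Xlast Q (i + 1)

end Exponents

end BinomialHK

end

/-!
Modulo `c₂ x^u + c₁ x^v` the monomial `x^(γ+v)` is a unit multiple of `x^(γ+u)`. So the monomials
fall into chains in the direction `v - u`, and a chain that meets a monomial outside the box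
`[0, Q)^m` vanishes. An exponent that decreases along the chains keeps them from running on
forever, and the monomials at the starting points of the chains that stay inside the box form a
basis of the quotient: the length is the number of these starting points.

They are counted one variable at a time, from the last variable to the first, together with the
number `c` of steps during which the chain has to stay in the box. An exponent `e` of `N_i` allows
no step if `e < b_i`, and `⌊(e - b_i) / a_i⌋` steps otherwise; in the box this is at most
`⌊(Q - 1 - b_i) / a_i⌋`, which is `M_{a_i} - p_{a_i}`. Summing over `e` gives the recursion for
`∫_j^{(N_i)}`, the count in the variables after `N_i` for `c = M_{a_r} - p_{a_r} - j`, while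
`G_{N_i}` is the count for `c = 0`. Without negative difference variables, inclusion and exclusion
turns the count into the products behind `Φ`.

The coefficients `C_j^{(N_i)}` of the expanded form arise by transposing the triangular linear map
that takes `∫^{(N_i)}` to `∫^{(N_{i+1})}`.
-/

namespace BinomialHK

/-! ### Chains of monomials -/

section Augmentation

variable {k R M : Type*} [Field k] [CommRing R] [Algebra k R] [AddCommGroup M] [Module R M]
  [Module k M] [IsScalarTower k R M]

theorem smul_eq_augmentation_smul [IsSimpleModule R M] (ε : R →ₐ[k] k)
    (hε : ∀ a, ε a = 0 → ∃ d : ℕ, ∀ x : M, a ^ d • x = 0) (a : R) (x : M) : a • x = ε a • x := by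
  have hprime : (Module.annihilator R M).IsPrime := IsSimpleModule.annihilator_isMaximal.isPrime
  obtain ⟨d, hd⟩ := hε (a - algebraMap k R (ε a)) (by simp)
  have hmem : a - algebraMap k R (ε a) ∈ Module.annihilator R M :=
    hprime.mem_of_pow_mem d (Module.mem_annihilator.2 hd)
  rw [← sub_eq_zero, ← algebraMap_smul R (ε a) x, ← sub_smul]
  exact Module.mem_annihilator.1 hmem x

theorem isSimpleModule_of_augmentation [IsSimpleModule R M] (ε : R →ₐ[k] k)
    (hε : ∀ a, ε a = 0 → ∃ d : ℕ, ∀ x : M, a ^ d • x = 0) : IsSimpleModule k M := by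
  have hnontrivial : Nontrivial M := IsSimpleModule.nontrivial R M
  rw [isSimpleModule_iff_toSpanSingleton_surjective]
  refine ⟨hnontrivial, fun x hx y => ?_⟩
  obtain ⟨a, rfl⟩ := IsSimpleModule.toSpanSingleton_surjective R hx y
  exact ⟨ε a, (smul_eq_augmentation_smul ε hε a x).symm⟩

end Augmentation

theorem length_eq_of_augmentation {k R : Type*} [Field k] [CommRing R] [Algebra k R]
    (ε : R →ₐ[k] k) {M : Type*} [AddCommGroup M] [Module R M] (hM : IsFiniteLength R M)
    [hk : Module k M] [hkR : IsScalarTower k R M]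
    (hε : ∀ a, ε a = 0 → ∃ d : ℕ, ∀ x : M, a ^ d • x = 0) :
    Module.length R M = Module.length k M := by
  induction hM generalizing hk hkR with
  | of_subsingleton => rw [Module.length_eq_zero, Module.length_eq_zero]
  | @of_simple_quotient M _ _ N hsimple _ ih =>
    have hlength : Module.length R N = Module.length k N :=
      ih fun a ha => (hε a ha).imp fun d hd x => Subtype.ext (hd x)
    have hquotient : IsSimpleModule k (M ⧸ N) :=
      isSimpleModule_of_augmentation ε fun a ha => (hε a ha).imp fun d hd => by
        rintro ⟨x⟩
        exact congrArg N.mkQ (hd x)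
    rw [Module.length_eq_add_of_exact N.subtype N.mkQ N.injective_subtype N.mkQ_surjective
        (LinearMap.exact_subtype_mkQ N),
      Module.length_eq_add_of_exact (N.subtype.restrictScalars k) (N.mkQ.restrictScalars k)
        N.injective_subtype N.mkQ_surjective (LinearMap.exact_subtype_mkQ N),
      hlength, Module.length_eq_one R (M ⧸ N), Module.length_eq_one k (M ⧸ N)]

theorem nonempty_quotient_equiv_of_map_eq_single {ι R V : Type*} [Finite ι] [DecidableEq ι]
    [CommRing R] [AddCommGroup V] [Module R V] {φ : V →ₗ[R] ι → R} {N : Submodule R V}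
    {e : ι → V} (hN : N ≤ LinearMap.ker φ) (he : ∀ i, φ (e i) = Pi.single i 1)
    (hspan : N ⊔ Submodule.span R (Set.range e) = ⊤) : Nonempty ((V ⧸ N) ≃ₗ[R] (ι → R)) := by
  have := Fintype.ofFinite ι
  have hcoord (c : ι → R) : φ (∑ i, c i • e i) = c := by
    ext j
    simp [he, Pi.single_apply]
  have hker : N = LinearMap.ker φ := by
    refine le_antisymm hN fun x hx => ?_
    obtain ⟨y, hy, z, hz, rfl⟩ := Submodule.mem_sup.1 (hspan ▸ Submodule.mem_top (x := x))
    obtain ⟨c, rfl⟩ := (Submodule.mem_span_range_iff_exists_fun R).1 hz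
    have hc : c = 0 := by rwa [LinearMap.mem_ker, map_add, hN hy, zero_add, hcoord] at hx
    simpa [hc] using hy
  exact ⟨Submodule.quotEquivOfEq _ _ hker ≪≫ₗ
    LinearMap.quotKerEquivOfSurjective φ fun c => ⟨_, hcoord c⟩⟩

section Chains

open MvPolynomial

/-- `Reaches u v β j α`: the exponent vector `α` arises from `β` by `j` steps
`γ + u ↦ γ + v`, each of which rewrites the term `x^u` of a binomial by its term `x^v`. -/
inductive Reaches {σ : Type*} (u v β : σ →₀ ℕ) : ℕ → (σ →₀ ℕ) → Prop
  | refl : Reaches u v β 0 β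
  | step {j : ℕ} {γ : σ →₀ ℕ} : Reaches u v β j (γ + u) → Reaches u v β (j + 1) (γ + v)

/-- `β` is the first exponent vector of a chain that never leaves the box `[0, Q)^σ`. -/
def IsChainStart {σ : Type*} (u v : σ →₀ ℕ) (Q : ℕ) (β : σ →₀ ℕ) : Prop :=
  ¬ v ≤ β ∧ ∀ j α, Reaches u v β j α → ∀ i, α i < Q

/-- The ideal `(x_i^Q | i) + (c₂ x^u + c₁ x^v)`. -/
noncomputable abbrev binomialIdeal {k σ : Type*} [CommRing k] (u v : σ →₀ ℕ) (Q : ℕ) (c₂ c₁ : k) :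
    Ideal (MvPolynomial σ k) :=
  Ideal.span (Set.range fun i => X i ^ Q) ⊔ Ideal.span {monomial u c₂ + monomial v c₁}

open Classical in
/-- The coefficient with which `x^α` is a multiple of `x^β` modulo `c₂ x^u + c₁ x^v`, where
`ρ = -c₂ / c₁`; it is `0` if the chain starting at `β` does not contain `α`. -/
noncomputable def chainCoeff {k σ : Type*} [CommRing k] (u v : σ →₀ ℕ) (ρ : k) (β α : σ →₀ ℕ) : k :=
  if h : ∃ j, Reaches u v β j α then ρ ^ h.choose else 0

/-- The linear map that sends a polynomial to its coordinates with respect to the monomials at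
the chain starts. -/
noncomputable def chainCoords {k σ : Type*} [CommRing k] (u v : σ →₀ ℕ) (Q : ℕ) (ρ : k) :
    MvPolynomial σ k →ₗ[k] ({β // IsChainStart u v Q β} → k) :=
  (basisMonomials σ k).constr k fun α β => chainCoeff u v ρ β.1 α

section Reaches

variable {σ : Type*} {u v α β γ : σ →₀ ℕ} {Q j : ℕ}

theorem Reaches.apply_eq (h : Reaches u v β j α) (i : σ) :
    (α i : ℤ) = β i + j * ((v i : ℤ) - u i) := by
  induction h with
  | refl => simp
  | step _ ih =>
    push_cast [Finsupp.add_apply] at ih ⊢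
    linear_combination ih

theorem Reaches.steps_unique {j' : ℕ} (huv : u ≠ v) (h : Reaches u v β j α)
    (h' : Reaches u v β j' α) : j = j' := by
  obtain ⟨i, hi⟩ := DFunLike.ne_iff.1 huv
  have hmul : (j : ℤ) * ((v i : ℤ) - u i) = j' * ((v i : ℤ) - u i) := by
    linear_combination h'.apply_eq i - h.apply_eq i
  exact_mod_cast mul_right_cancel₀ (by omega : ((v i : ℤ) - u i) ≠ 0) hmul

theorem reaches_add_iff (hβ : ¬ v ≤ β) :
    Reaches u v β j (γ + v) ↔ ∃ j', j = j' + 1 ∧ Reaches u v β j' (γ + u) := by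
  refine ⟨fun h => ?_, by rintro ⟨j', rfl, h⟩; exact h.step⟩
  generalize hα : γ + v = α at h
  cases h with
  | refl => exact (hβ (hα ▸ le_add_self)).elim
  | step h => exact ⟨_, rfl, add_right_cancel hα ▸ h⟩

theorem reaches_iff_of_not_le (hα : ¬ v ≤ α) : Reaches u v β j α ↔ j = 0 ∧ α = β := by
  refine ⟨fun h => ?_, by rintro ⟨rfl, rfl⟩; exact .refl⟩
  cases h with
  | refl => exact ⟨rfl, rfl⟩
  | step => exact (hα le_add_self).elim

theorem IsChainStart.lt (h : IsChainStart u v Q β) (i : σ) : β i < Q :=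
  h.2 0 β .refl i

instance [Finite σ] : Finite {β // IsChainStart u v Q β} :=
  .of_injective (fun β i => (⟨β.1 i, β.2.lt i⟩ : Fin Q)) fun _ _ h =>
    Subtype.ext (Finsupp.ext fun i => congrArg Fin.val (congrFun h i))

end Reaches

section Coordinates

variable {k σ : Type*} [CommRing k] {u v α β : σ →₀ ℕ} {Q : ℕ} {ρ c₂ c₁ : k}

theorem chainCoeff_of_reaches {j : ℕ} (huv : u ≠ v) (h : Reaches u v β j α) :
    chainCoeff u v ρ β α = ρ ^ j := by
  have hex : ∃ j, Reaches u v β j α := ⟨j, h⟩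
  rw [chainCoeff, dif_pos hex, hex.choose_spec.steps_unique huv h]

theorem chainCoeff_of_not_reaches (h : ∀ j, ¬ Reaches u v β j α) : chainCoeff u v ρ β α = 0 :=
  dif_neg fun ⟨j, hj⟩ => h j hj

theorem chainCoeff_add (huv : u ≠ v) (hβ : ¬ v ≤ β) (γ : σ →₀ ℕ) :
    chainCoeff u v ρ β (γ + v) = ρ * chainCoeff u v ρ β (γ + u) := by
  by_cases h : ∃ j, Reaches u v β j (γ + u)
  · obtain ⟨j, hj⟩ := h
    rw [chainCoeff_of_reaches huv hj, chainCoeff_of_reaches huv hj.step, pow_succ']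
  · have hγ : ∀ j, ¬ Reaches u v β j (γ + v) := fun j hj =>
      h <| (reaches_add_iff hβ).1 hj |>.imp fun _ => And.right
    rw [chainCoeff_of_not_reaches (not_exists.1 h), chainCoeff_of_not_reaches hγ, mul_zero]

theorem chainCoeff_of_le (hβ : IsChainStart u v Q β) {i : σ} (hα : Q ≤ α i) :
    chainCoeff u v ρ β α = 0 :=
  chainCoeff_of_not_reaches fun j hj => (hβ.2 j α hj i).not_ge hα

open Classical in
theorem chainCoeff_of_not_le (huv : u ≠ v) (hα : ¬ v ≤ α) :
    chainCoeff u v ρ β α = if α = β then 1 else 0 := by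
  split_ifs with h
  · rw [chainCoeff_of_reaches huv ((reaches_iff_of_not_le hα).2 ⟨rfl, h⟩), pow_zero]
  · exact chainCoeff_of_not_reaches fun j hj => h ((reaches_iff_of_not_le hα).1 hj).2

theorem chainCoords_monomial (c : k) (α : σ →₀ ℕ) (β : {β // IsChainStart u v Q β}) :
    chainCoords u v Q ρ (monomial α c) β = c * chainCoeff u v ρ β.1 α := by
  have h : monomial α c = c • basisMonomials σ k α := by
    rw [coe_basisMonomials, smul_monomial, smul_eq_mul, mul_one]
  rw [h, map_smul, chainCoords, Module.Basis.constr_basis, Pi.smul_apply, smul_eq_mul]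

open Classical in
theorem chainCoords_monomial_chainStart (huv : u ≠ v) (β : {β // IsChainStart u v Q β}) :
    chainCoords u v Q ρ (monomial β.1 1) = Pi.single β 1 := by
  ext β'
  rw [chainCoords_monomial, chainCoeff_of_not_le huv β.2.1, one_mul, Pi.single_apply]
  exact if_congr (by rw [eq_comm, Subtype.ext_iff]) rfl rfl

theorem chainCoords_monomial_mul_X_pow (γ : σ →₀ ℕ) (c : k) (i : σ) :
    chainCoords u v Q ρ (monomial γ c * X i ^ Q) = 0 := by
  ext β
  rw [← monomial_add_single, chainCoords_monomial, chainCoeff_of_le (i := i) β.2 (by simp),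
    mul_zero, Pi.zero_apply]

theorem chainCoords_monomial_mul_binomial (huv : u ≠ v) (hρ : c₂ + c₁ * ρ = 0) (γ : σ →₀ ℕ)
    (c : k) : chainCoords u v Q ρ (monomial γ c * (monomial u c₂ + monomial v c₁)) = 0 := by
  ext β
  rw [mul_add, monomial_mul, monomial_mul, map_add, Pi.add_apply, chainCoords_monomial,
    chainCoords_monomial, chainCoeff_add huv β.2.1, Pi.zero_apply]
  linear_combination c * chainCoeff u v ρ β.1 (γ + u) * hρ

theorem binomialIdeal_le_ker_chainCoords (huv : u ≠ v) (hρ : c₂ + c₁ * ρ = 0) :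
    (binomialIdeal u v Q c₂ c₁).restrictScalars k ≤ LinearMap.ker (chainCoords u v Q ρ) := by
  intro f hf
  suffices h : ∀ g, chainCoords u v Q ρ (g * f) = 0 by simpa using h 1
  rw [Submodule.restrictScalars_mem, binomialIdeal, ← Ideal.span_union] at hf
  induction hf using Submodule.span_induction with
  | zero => simp
  | add f f' _ _ hf hf' => intro g; rw [mul_add, map_add, hf, hf', add_zero]
  | smul a f _ hf => intro g; rw [smul_eq_mul, ← mul_assoc]; exact hf _
  | mem f hf =>
    intro g
    induction g using MvPolynomial.induction_on' with
    | add g g' hg hg' => rw [add_mul, map_add, hg, hg', add_zero]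
    | monomial γ c =>
      obtain ⟨i, rfl⟩ | rfl := hf
      · exact chainCoords_monomial_mul_X_pow γ c i
      · exact chainCoords_monomial_mul_binomial huv hρ γ c

theorem monomial_mem_binomialIdeal {i : σ} (hα : Q ≤ α i) (c : k) :
    monomial α c ∈ binomialIdeal u v Q c₂ c₁ := by
  have h : monomial α c = monomial (α - Finsupp.single i Q) c * X i ^ Q := by
    rw [← monomial_add_single, tsub_add_cancel_of_le (by simpa using hα)]
  rw [h]
  exact Ideal.mul_mem_left _ _ (Ideal.mem_sup_left (Ideal.subset_span ⟨i, rfl⟩))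

end Coordinates

section Spanning

variable {k σ : Type*} [Field k] {u v α β : σ →₀ ℕ} {Q : ℕ} {c₂ c₁ : k}

theorem monomial_add_mem_iff {W : Submodule k (MvPolynomial σ k)} (hc₂ : c₂ ≠ 0) (hc₁ : c₁ ≠ 0)
    (hW : (binomialIdeal u v Q c₂ c₁).restrictScalars k ≤ W) (γ : σ →₀ ℕ) :
    monomial (γ + v) (1 : k) ∈ W ↔ monomial (γ + u) (1 : k) ∈ W := by
  have h : c₂ • monomial (γ + u) (1 : k) + c₁ • monomial (γ + v) (1 : k) ∈ W := by
    have hfactor : c₂ • monomial (γ + u) (1 : k) + c₁ • monomial (γ + v) (1 : k)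
        = monomial γ 1 * (monomial u c₂ + monomial v c₁) := by
      simp [mul_add, monomial_mul, smul_monomial]
    rw [hfactor]
    exact hW (Ideal.mul_mem_left _ _ (Ideal.mem_sup_right (Ideal.mem_span_singleton_self _)))
  rw [← W.smul_mem_iff hc₁, ← W.smul_mem_iff hc₂ (x := monomial (γ + u) (1 : k))]
  exact ⟨fun h' => (W.add_mem_iff_left h').1 h, fun h' => (W.add_mem_iff_right h').1 h⟩

theorem Reaches.monomial_mem_iff {W : Submodule k (MvPolynomial σ k)} {j : ℕ} (hc₂ : c₂ ≠ 0)
    (hc₁ : c₁ ≠ 0) (hW : (binomialIdeal u v Q c₂ c₁).restrictScalars k ≤ W)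
    (h : Reaches u v β j α) : monomial α (1 : k) ∈ W ↔ monomial β (1 : k) ∈ W := by
  induction h with
  | refl => rfl
  | step _ ih => exact (monomial_add_mem_iff hc₂ hc₁ hW _).trans ih

theorem isChainStart_or_monomial_mem (hc₂ : c₂ ≠ 0) (hc₁ : c₁ ≠ 0) (hβ : ¬ v ≤ β) :
    IsChainStart u v Q β ∨ monomial β (1 : k) ∈ binomialIdeal u v Q c₂ c₁ := by
  refine or_iff_not_imp_left.2 fun hstart => ?_
  obtain ⟨j, α, hα, i, hi⟩ : ∃ j α, Reaches u v β j α ∧ ∃ i, Q ≤ α i := by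
    by_contra! h
    exact hstart ⟨hβ, h⟩
  exact (hα.monomial_mem_iff hc₂ hc₁ le_rfl).1 (monomial_mem_binomialIdeal hi 1)

theorem binomialIdeal_sup_span_chainStart {i : σ} (hi : v i < u i) (hc₂ : c₂ ≠ 0)
    (hc₁ : c₁ ≠ 0) :
    (binomialIdeal u v Q c₂ c₁).restrictScalars k ⊔
      Submodule.span k (Set.range fun β : {β // IsChainStart u v Q β} => monomial β.1 1) = ⊤ := by
  set W := (binomialIdeal u v Q c₂ c₁).restrictScalars k ⊔
    Submodule.span k (Set.range fun β : {β // IsChainStart u v Q β} => monomial β.1 1)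
  have hIW : (binomialIdeal u v Q c₂ c₁).restrictScalars k ≤ W := le_sup_left
  -- walking backwards along a chain increases the exponent of `x_i`
  have hmonomial (d : ℕ) : ∀ α : σ →₀ ℕ, Q ≤ α i + d → monomial α (1 : k) ∈ W := by
    induction d with
    | zero => exact fun α hα => hIW (monomial_mem_binomialIdeal hα 1)
    | succ d ih =>
      intro α hα
      by_cases hv : v ≤ α
      · obtain ⟨γ, rfl⟩ : ∃ γ, α = γ + v := ⟨α - v, (tsub_add_cancel_of_le hv).symm⟩
        rw [Finsupp.add_apply] at hα
        exact (monomial_add_mem_iff hc₂ hc₁ hIW γ).2 (ih _ (by rw [Finsupp.add_apply]; omega))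
      · obtain hα' | hα' := isChainStart_or_monomial_mem hc₂ hc₁ hv
        · exact Submodule.mem_sup_right (Submodule.subset_span ⟨⟨α, hα'⟩, rfl⟩)
        · exact hIW hα'
  rw [Submodule.eq_top_iff']
  intro f
  induction f using MvPolynomial.induction_on' with
  | add f g hf hg => exact add_mem hf hg
  | monomial α c =>
    have h := W.smul_mem c (hmonomial Q α (by omega))
    rwa [smul_monomial, smul_eq_mul, mul_one] at h

theorem exists_pow_mem_binomialIdeal {f : MvPolynomial σ k} (hf : aeval (0 : σ → k) f = 0) :
    ∃ d, f ^ d ∈ binomialIdeal u v Q c₂ c₁ := by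
  have hvars : idealOfVars σ k ≤ (binomialIdeal u v Q c₂ c₁).radical := by
    rw [Ideal.span_le]
    rintro _ ⟨i, rfl⟩
    exact ⟨Q, Ideal.mem_sup_left (Ideal.subset_span ⟨i, rfl⟩)⟩
  refine hvars ?_
  rw [← pow_one (idealOfVars σ k), mem_pow_idealOfVars_iff']
  intro α hα
  rw [Nat.lt_one_iff, Finsupp.degree_eq_zero_iff] at hα
  rw [hα]
  simpa [aeval_zero, constantCoeff_eq] using hf

end Spanning

section Length

variable {k σ : Type*} [Field k] {u v : σ →₀ ℕ} {Q : ℕ} {c₂ c₁ : k}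

theorem nonempty_quotient_binomialIdeal_equiv [Finite σ] {i : σ} (hi : v i < u i) (hc₂ : c₂ ≠ 0)
    (hc₁ : c₁ ≠ 0) :
    Nonempty ((MvPolynomial σ k ⧸ binomialIdeal u v Q c₂ c₁) ≃ₗ[k]
      ({β // IsChainStart u v Q β} → k)) := by
  classical
  have huv : u ≠ v := fun h => hi.ne' (DFunLike.congr_fun h i)
  have hρ : c₂ + c₁ * (-c₂ / c₁) = 0 := by rw [mul_div_cancel₀ _ hc₁, add_neg_cancel]
  obtain ⟨e⟩ := nonempty_quotient_equiv_of_map_eq_single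
    (binomialIdeal_le_ker_chainCoords (Q := Q) huv hρ) (chainCoords_monomial_chainStart huv)
    (binomialIdeal_sup_span_chainStart hi hc₂ hc₁)
  exact ⟨(Submodule.Quotient.restrictScalarsEquiv k _).symm ≪≫ₗ e⟩

theorem length_quotient_binomialIdeal [Finite σ] {i : σ} (hi : v i < u i) (hc₂ : c₂ ≠ 0)
    (hc₁ : c₁ ≠ 0) :
    Module.length (MvPolynomial σ k) (MvPolynomial σ k ⧸ binomialIdeal u v Q c₂ c₁) =
      Nat.card {β // IsChainStart u v Q β} := by
  have := Fintype.ofFinite {β // IsChainStart u v Q β}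
  obtain ⟨e⟩ := nonempty_quotient_binomialIdeal_equiv (Q := Q) hi hc₂ hc₁
  have hfinite : Module.Finite k (MvPolynomial σ k ⧸ binomialIdeal u v Q c₂ c₁) :=
    .equiv e.symm
  have hlength : IsFiniteLength (MvPolynomial σ k)
      (MvPolynomial σ k ⧸ binomialIdeal u v Q c₂ c₁) :=
    isFiniteLength_iff_isNoetherian_isArtinian.2
      ⟨isNoetherian_of_tower k inferInstance, isArtinian_of_tower k inferInstance⟩
  rw [length_eq_of_augmentation (aeval 0) hlength, e.length_eq, Module.length_eq_finrank,
    Module.finrank_pi, Nat.card_eq_fintype_card]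
  intro f hf
  obtain ⟨d, hd⟩ := exists_pow_mem_binomialIdeal (u := u) (v := v) (Q := Q) (c₂ := c₂)
    (c₁ := c₁) hf
  refine ⟨d, ?_⟩
  rintro ⟨g⟩
  exact Ideal.Quotient.eq_zero_iff_mem.2 (Ideal.mul_mem_right g _ hd)

end Length

end Chains

/-! ### Counting the starting points of chains -/

section Counting

section Sums

variable {R : Type*} [CommSemiring R] {a : ℕ}

theorem sum_range_mul_div (g : ℕ → R) (ha : 0 < a) (c : ℕ) :
    ∑ y ∈ Finset.range (a * c), g (y / a) = a * ∑ l ∈ Finset.range c, g l := by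
  induction c with
  | zero => simp
  | succ c ih =>
    have hblock : ∀ y ∈ Finset.range a, g ((a * c + y) / a) = g c := fun y hy => by
      rw [Nat.mul_add_div ha, Nat.div_eq_of_lt (Finset.mem_range.1 hy), add_zero]
    rw [mul_add_one, Finset.sum_range_add, ih, Finset.sum_congr rfl hblock, Finset.sum_range_succ,
      Finset.sum_const, Finset.card_range, nsmul_eq_mul, mul_add]

theorem sum_range_min_div (g : ℕ → R) (ha : 0 < a) (c d : ℕ) :
    ∑ y ∈ Finset.range (a * c + d), g (min c (y / a)) =
      a * ∑ l ∈ Finset.range c, g l + d * g c := by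
  have hlow : ∀ y ∈ Finset.range (a * c), g (min c (y / a)) = g (y / a) := fun y hy => by
    rw [min_eq_right (Nat.div_lt_of_lt_mul (Finset.mem_range.1 hy)).le]
  have hhigh : ∀ y ∈ Finset.range d, g (min c ((a * c + y) / a)) = g c := fun y _ => by
    rw [Nat.mul_add_div ha, min_eq_left (Nat.le_add_right c _)]
  rw [Finset.sum_range_add, Finset.sum_congr rfl hlow, Finset.sum_congr rfl hhigh,
    sum_range_mul_div g ha, Finset.sum_const, Finset.card_range, nsmul_eq_mul]

end Sums

/-- The `j` steps `β ↦ β + (v - u)` from `β` are all applied to exponent vectors `≥ u`. -/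
def CanStep {ι : Type*} (u v β : ι → ℕ) (j : ℕ) : Prop :=
  ∀ l < j, ∀ i, (u i : ℤ) ≤ β i + l * ((v i : ℤ) - u i)

/-- `β` starts a chain, and the first `c` steps of the chain do not leave the box `[0, Q)^ι`. -/
def StartsWithin {ι : Type*} (u v : ι → ℕ) (Q c : ℕ) (β : ι → ℕ) : Prop :=
  (∃ i, β i < v i) ∧
    ∀ j ≤ c, CanStep u v β j → ∀ i, (β i : ℤ) + j * ((v i : ℤ) - u i) < Q

open Classical in
/-- The number of points of the box `[0, Q)^n` that start a chain whose first `c` steps do not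
leave the box. -/
noncomputable def startCount {n : ℕ} (u v : Fin n → ℕ) (Q c : ℕ) : ℤ :=
  ∑ β : Fin n → Fin Q, if StartsWithin u v Q c (fun i => β i) then 1 else 0

section ChainStart

variable {σ : Type*} {u v β : σ →₀ ℕ} {Q j : ℕ}

theorem canStep_succ {ι : Type*} {u v β : ι → ℕ} {j : ℕ} : CanStep u v β (j + 1) ↔
    CanStep u v β j ∧ ∀ i, (u i : ℤ) ≤ β i + j * ((v i : ℤ) - u i) :=
  Nat.forall_lt_succ_right

theorem Reaches.canStep {α : σ →₀ ℕ} (h : Reaches u v β j α) : CanStep u v β j := by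
  induction h with
  | refl => simp [CanStep]
  | step h ih =>
    refine canStep_succ.2 ⟨ih, fun i => ?_⟩
    rw [← h.apply_eq i]
    simp

theorem CanStep.exists_reaches (h : CanStep u v β j) : ∃ α, Reaches u v β j α := by
  induction j with
  | zero => exact ⟨β, .refl⟩
  | succ j ih =>
    obtain ⟨hj, hle⟩ := canStep_succ.1 h
    obtain ⟨α, hα⟩ := ih hj
    obtain ⟨γ, rfl⟩ : ∃ γ, α = γ + u := by
      refine ⟨α - u, (tsub_add_cancel_of_le fun i => ?_).symm⟩
      exact_mod_cast (hle i).trans_eq (hα.apply_eq i).symm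
    exact ⟨_, hα.step⟩

theorem isChainStart_iff : IsChainStart u v Q β ↔ ∀ c, StartsWithin u v Q c β := by
  have hstart : ¬ v ≤ β ↔ ∃ i, β i < v i := by simp [Finsupp.le_def]
  have hbox : (∀ j α, Reaches u v β j α → ∀ i, α i < Q) ↔
      ∀ j, CanStep u v β j → ∀ i, (β i : ℤ) + j * ((v i : ℤ) - u i) < Q := by
    refine ⟨fun h j hj i => ?_, fun h j α hα i => ?_⟩
    · obtain ⟨α, hα⟩ := hj.exists_reaches
      exact hα.apply_eq i ▸ Int.ofNat_lt.2 (h j α hα i)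
    · exact Int.ofNat_lt.1 (hα.apply_eq i ▸ h j hα.canStep i)
  rw [IsChainStart, hstart, hbox]
  exact ⟨fun h c => ⟨h.1, fun j _ => h.2 j⟩, fun h => ⟨(h 0).1, fun j => (h j).2 j le_rfl⟩⟩

theorem startsWithin_of_steps_le {ι : Type*} {u v β : ι → ℕ} {Q K : ℕ} {i : ι} (hβ : β i < Q)
    (hK : (Q : ℤ) - u i ≤ K * ((u i : ℤ) - v i)) (h : StartsWithin u v Q K β) (c : ℕ) :
    StartsWithin u v Q c β := by
  refine ⟨h.1, fun j _ hj => h.2 j (le_of_not_gt fun hlt => ?_) hj⟩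
  have hstep := hj K hlt i
  linarith

theorem natCard_isChainStart {n Q K : ℕ} {u v : Fin n →₀ ℕ} {i : Fin n}
    (hK : (Q : ℤ) - u i ≤ K * ((u i : ℤ) - v i)) :
    (Nat.card {β // IsChainStart u v Q β} : ℤ) = startCount u v Q K := by
  classical
  have hiff (β : Fin n → Fin Q) : StartsWithin u v Q K (fun i => β i) ↔
      IsChainStart u v Q (Finsupp.equivFunOnFinite.symm fun i => (β i : ℕ)) := by
    rw [isChainStart_iff, Finsupp.coe_equivFunOnFinite_symm]
    exact ⟨startsWithin_of_steps_le (β i).2 hK, fun h => h K⟩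
  let e : {β : Fin n → Fin Q // StartsWithin u v Q K fun i => β i} ≃
      {β // IsChainStart u v Q β} :=
    { toFun := fun β => ⟨_, (hiff β.1).1 β.2⟩
      invFun := fun β => ⟨fun i => ⟨β.1 i, β.2.lt i⟩, (hiff _).2 (by
        convert β.2
        ext i
        simp)⟩
      left_inv := fun β => by ext i; simp
      right_inv := fun β => by ext i; simp }
  rw [← Nat.card_congr e, startCount, Finset.sum_boole, Nat.card_eq_fintype_card,
    Fintype.card_subtype]

end ChainStart

section FirstVariable

variable {n Q c : ℕ} {u v : Fin (n + 1) → ℕ}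

theorem startsWithin_cons_of_lt (huv : v 0 ≤ u 0) {x : ℕ} (hx : x < v 0) {β : Fin n → ℕ}
    (hxQ : x < Q) (hβ : ∀ i, β i < Q) : StartsWithin u v Q c (Fin.cons x β : Fin (n + 1) → ℕ) := by
  refine ⟨⟨0, hx⟩, fun j _ hj => ?_⟩
  obtain rfl | hpos := j.eq_zero_or_pos
  · simpa [Fin.forall_fin_succ] using ⟨hxQ, hβ⟩
  · have hstep := hj 0 hpos 0
    simp only [Fin.cons_zero, Nat.cast_zero, zero_mul, add_zero, Nat.cast_le] at hstep
    omega

theorem startsWithin_cons_iff {c' x : ℕ} (hx : v 0 ≤ x)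
    (hbox : ∀ j ≤ c', (x : ℤ) + j * ((v 0 : ℤ) - u 0) < Q)
    (hc' : ∀ j, j ≤ c' ↔ j ≤ c ∧ ∀ l < j, (u 0 : ℤ) ≤ x + l * ((v 0 : ℤ) - u 0))
    {β : Fin n → ℕ} : StartsWithin u v Q c (Fin.cons x β : Fin (n + 1) → ℕ) ↔
      StartsWithin (Fin.tail u) (Fin.tail v) Q c' β := by
  simp only [StartsWithin, CanStep, Fin.exists_fin_succ, Fin.forall_fin_succ, Fin.cons_zero,
    Fin.cons_succ, Fin.tail, hx.not_gt, false_or, forall_and, and_imp]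
  refine and_congr_right fun _ => ⟨fun h j hj => ?_, fun h => ⟨?_, ?_⟩⟩
  · exact h.2 j ((hc' j).1 hj).1 ((hc' j).1 hj).2
  · exact fun j hj hhead _ => hbox j ((hc' j).2 ⟨hj, hhead⟩)
  · exact fun j hj hhead htail => h j ((hc' j).2 ⟨hj, hhead⟩) htail

theorem startCount_succ (huv : v 0 ≤ u 0) (hv : v 0 ≤ Q) (f : ℕ → ℕ)
    (hf : ∀ x < Q, v 0 ≤ x → ∀ β : Fin n → ℕ,
      StartsWithin u v Q c (Fin.cons x β : Fin (n + 1) → ℕ) ↔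
        StartsWithin (Fin.tail u) (Fin.tail v) Q (f (x - v 0)) β) :
    startCount u v Q c = v 0 * (Q : ℤ) ^ n +
      ∑ y ∈ Finset.range (Q - v 0), startCount (Fin.tail u) (Fin.tail v) Q (f y) := by
  classical
  have hslice (x : Fin Q) : (∑ β : Fin n → Fin Q,
      if StartsWithin u v Q c (fun i => (Fin.cons x β : Fin (n + 1) → Fin Q) i)
        then (1 : ℤ) else 0) =
      if (x : ℕ) < v 0 then (Q : ℤ) ^ n
        else startCount (Fin.tail u) (Fin.tail v) Q (f (x - v 0)) := by
    have hcons (β : Fin n → Fin Q) : (fun i => ((Fin.cons x β : Fin (n + 1) → Fin Q) i : ℕ)) =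
        (Fin.cons (x : ℕ) fun i => (β i : ℕ)) := Fin.comp_cons (β := ℕ) Fin.val x β
    simp only [hcons]
    split_ifs with hx
    · simp [startsWithin_cons_of_lt huv hx x.2 fun _ => Fin.is_lt _]
    · exact Finset.sum_congr rfl fun β _ => if_congr (hf x x.2 (not_lt.1 hx) _) rfl rfl
  rw [startCount, ← (Fin.consEquiv fun _ => Fin Q).sum_comp, Fintype.sum_prod_type]
  simp only [Fin.consEquiv_apply, hslice]
  rw [Fin.sum_univ_eq_sum_range (fun x => if x < v 0 then (Q : ℤ) ^ n
      else startCount (Fin.tail u) (Fin.tail v) Q (f (x - v 0))),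
    ← Finset.sum_range_add_sum_Ico _ hv, Finset.sum_Ico_eq_sum_range]
  congr 1
  · rw [Finset.sum_congr rfl fun x hx => if_pos (Finset.mem_range.1 hx)]
    simp
  · simp

theorem startCount_succ_of_eq (huv : u 0 = v 0) (hv : v 0 ≤ Q) :
    startCount u v Q c =
      (Q - v 0) * startCount (Fin.tail u) (Fin.tail v) Q c + v 0 * (Q : ℤ) ^ n := by
  rw [startCount_succ huv.ge hv (fun _ => c)]
  · simp [hv, add_comm]
  · exact fun x hxQ hx β => startsWithin_cons_iff hx (by simp [huv, hxQ]) (by simp [huv, hx])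

theorem forall_lt_le_add_mul_iff {u v x : ℕ} (hvu : v < u) (hx : v ≤ x) (j : ℕ) :
    (∀ l < j, (u : ℤ) ≤ x + l * ((v : ℤ) - u)) ↔ j ≤ (x - v) / (u - v) := by
  rw [Nat.le_div_iff_mul_le (by omega)]
  zify [hx, hvu.le]
  constructor
  · intro h
    cases j with
    | zero => simpa using hx
    | succ l =>
      push_cast
      linarith [h l (by simp)]
  · intro h l hl
    have hmul : ((l : ℤ) + 1) * ((u : ℤ) - v) ≤ j * ((u : ℤ) - v) :=
      mul_le_mul_of_nonneg_right (by exact_mod_cast hl) (by omega)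
    linarith

theorem startsWithin_cons_iff_of_lt (hvu : v 0 < u 0) {x : ℕ} (hxQ : x < Q) (hx : v 0 ≤ x)
    (β : Fin n → ℕ) : StartsWithin u v Q c (Fin.cons x β : Fin (n + 1) → ℕ) ↔
      StartsWithin (Fin.tail u) (Fin.tail v) Q (min c ((x - v 0) / (u 0 - v 0))) β := by
  refine startsWithin_cons_iff hx (fun j _ => ?_) fun j => ?_
  · have hstep : (j : ℤ) * ((v 0 : ℤ) - u 0) ≤ 0 :=
      mul_nonpos_of_nonneg_of_nonpos (by omega) (by omega)
    omega
  · rw [le_min_iff, forall_lt_le_add_mul_iff hvu hx]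

theorem startCount_succ_of_lt (hvu : v 0 < u 0) (hv : v 0 ≤ Q)
    (hc : (u 0 - v 0) * c ≤ Q - v 0) :
    startCount u v Q c = v 0 * (Q : ℤ) ^ n
      + ((u 0 : ℤ) - v 0) * ∑ l ∈ Finset.range c, startCount (Fin.tail u) (Fin.tail v) Q l
      + (Q - v 0 - ((u 0 : ℤ) - v 0) * c) * startCount (Fin.tail u) (Fin.tail v) Q c := by
  obtain ⟨d, hd⟩ := Nat.exists_eq_add_of_le hc
  rw [startCount_succ hvu.le hv (fun y => min c (y / (u 0 - v 0)))
    fun x hxQ hx => startsWithin_cons_iff_of_lt hvu hxQ hx, hd, sum_range_min_div _ (by omega)]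
  zify [hv, hvu.le] at hd ⊢
  linear_combination -startCount (Fin.tail u) (Fin.tail v) Q c * hd

end FirstVariable

section Product

variable {n Q c : ℕ} {u v : Fin n → ℕ}

theorem card_filter_le_and_add_lt (Q A d : ℕ) :
    (({x : Fin Q | A ≤ x ∧ (x : ℤ) + d < Q} : Finset (Fin Q)).card : ℤ) =
      max 0 ((Q : ℤ) - d - A) := by
  have hmap : ({x : Fin Q | A ≤ x ∧ (x : ℤ) + d < Q} : Finset (Fin Q)).map Fin.valEmbedding =
      Finset.Ico A (Q - d) := by
    ext x
    simp only [Finset.mem_map, Finset.mem_filter_univ, Fin.valEmbedding_apply, Finset.mem_Ico]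
    refine ⟨?_, fun hx => ⟨⟨x, by omega⟩, ?_, rfl⟩⟩
    · rintro ⟨x, hx, rfl⟩
      omega
    · dsimp only
      omega
  rw [← Finset.card_map Fin.valEmbedding, hmap, Nat.card_Ico]
  omega

theorem sum_ite_forall_le_and_add_lt (w d : Fin n → ℕ) :
    (∑ β : Fin n → Fin Q,
      if (∀ i, w i ≤ β i) ∧ ∀ i, (β i : ℤ) + d i < Q then (1 : ℤ) else 0) =
      ∏ i, max 0 ((Q : ℤ) - d i - w i) := by
  simp only [← card_filter_le_and_add_lt]
  rw [Finset.sum_boole, ← Nat.cast_prod, ← Fintype.card_piFinset]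
  congr 2
  ext β
  simp [forall_and]

theorem sum_ite_forall_le {w : Fin n → ℕ} (hw : ∀ i, w i ≤ Q) :
    (∑ β : Fin n → Fin Q, if ∀ i, w i ≤ β i then (1 : ℤ) else 0) = ∏ i, ((Q : ℤ) - w i) := by
  have h := sum_ite_forall_le_and_add_lt (Q := Q) w 0
  simpa [hw] using h

theorem startCount_zero (hv : ∀ i, v i ≤ Q) :
    startCount u v Q 0 = (Q : ℤ) ^ n - ∏ i, ((Q : ℤ) - v i) := by
  have hone : ∑ _ : Fin n → Fin Q, (1 : ℤ) = (Q : ℤ) ^ n := by simp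
  rw [← sum_ite_forall_le hv, ← hone, ← Finset.sum_sub_distrib, startCount]
  refine Finset.sum_congr rfl fun β _ => ?_
  have hstart : StartsWithin u v Q 0 (fun i => β i) ↔ ¬ ∀ i, v i ≤ β i := by
    simp [StartsWithin]
  by_cases h : ∀ i, v i ≤ β i <;> simp [hstart, h]

theorem startsWithin_iff_of_le (huv : u ≤ v) {β : Fin n → ℕ} (hβ : ∀ i, β i < Q) :
    StartsWithin u v Q c β ↔ ¬ (∀ i, v i ≤ β i) ∧
      ((∀ i, u i ≤ β i) → ∀ i, (β i : ℤ) + (c * (v i - u i) : ℕ) < Q) := by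
  have hcast (i : Fin n) : ((c * (v i - u i) : ℕ) : ℤ) = c * ((v i : ℤ) - u i) := by
    push_cast [huv i]
    rfl
  have hnonneg (j : ℕ) (i : Fin n) : (0 : ℤ) ≤ j * ((v i : ℤ) - u i) :=
    mul_nonneg j.cast_nonneg (sub_nonneg.2 (Nat.cast_le.2 (huv i)))
  simp only [StartsWithin, not_forall, not_le, hcast]
  refine and_congr_right fun _ =>
    ⟨fun h hu => h c le_rfl fun l _ i => ?_, fun h j hj hstep i => ?_⟩
  · linarith [hnonneg l i, Nat.cast_le (α := ℤ) |>.2 (hu i)]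
  · obtain rfl | hpos := j.eq_zero_or_pos
    · simpa using hβ i
    · have hu (i : Fin n) : u i ≤ β i := by simpa using hstep 0 hpos i
      have hmono : (j : ℤ) * ((v i : ℤ) - u i) ≤ c * ((v i : ℤ) - u i) :=
        mul_le_mul_of_nonneg_right (Nat.cast_le.2 hj) (sub_nonneg.2 (Nat.cast_le.2 (huv i)))
      linarith [h hu i]

theorem startCount_of_le (huv : u ≤ v) (hv : ∀ i, v i ≤ Q) :
    startCount u v Q c = (Q : ℤ) ^ n - ∏ i, ((Q : ℤ) - u i)
      + ∏ i, max 0 ((Q : ℤ) - c * ((v i : ℤ) - u i) - u i)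
      - ∏ i, max 0 ((Q : ℤ) - c * ((v i : ℤ) - u i) - v i) := by
  have hcast (i : Fin n) : (c : ℤ) * ((v i : ℤ) - u i) = (c * (v i - u i) : ℕ) := by
    push_cast [huv i]
    rfl
  have hone : ∑ _ : Fin n → Fin Q, (1 : ℤ) = (Q : ℤ) ^ n := by simp
  simp only [hcast, ← sum_ite_forall_le_and_add_lt, ← hone, startCount,
    ← sum_ite_forall_le fun i => (huv i).trans (hv i)]
  rw [← Finset.sum_sub_distrib, ← Finset.sum_add_distrib, ← Finset.sum_sub_distrib]
  refine Finset.sum_congr rfl fun β _ => ?_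
  have hstart := startsWithin_iff_of_le (c := c) huv fun i => (β i).2
  have hle : (∀ i, v i ≤ β i) → ∀ i, u i ≤ β i := fun h i => (huv i).trans (h i)
  simp only [hstart]
  by_cases h₁ : ∀ i, u i ≤ β i <;> by_cases h₂ : ∀ i, v i ≤ β i <;>
    by_cases h₃ : ∀ i, (β i : ℤ) + (c * (v i - u i) : ℕ) < Q <;>
    first | exact absurd (hle h₂) h₁ | (simp only [h₁, h₂, h₃]; simp)

end Product

end Counting

/-! ### Finite sums and products -/

section FinsetSums

variable {ι R : Type*} [CommSemiring R]

theorem sum_Icc_eq_sum_Ico_add_sum_Ioc {M : Type*} [LinearOrder ι] [LocallyFiniteOrder ι]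
    [AddCommMonoid M] {z x w : ι} (hzx : z ≤ x) (hxw : x ≤ w) (f : ι → M) :
    ∑ j ∈ Finset.Icc z w, f j = ∑ j ∈ Finset.Ico z x, f j + f x + ∑ j ∈ Finset.Ioc x w, f j := by
  have hdisj : Disjoint (Finset.Icc z x) (Finset.Ioc x w) :=
    Finset.disjoint_left.2 fun _ hj hj' =>
      (Finset.mem_Icc.1 hj).2.not_gt (Finset.mem_Ioc.1 hj').1
  have hunion : Finset.Icc z w = Finset.Icc z x ∪ Finset.Ioc x w := by
    rw [← Finset.coe_inj, Finset.coe_union, Finset.coe_Icc, Finset.coe_Icc, Finset.coe_Ioc,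
      Set.Icc_union_Ioc_eq_Icc hzx hxw]
  rw [hunion, Finset.sum_union hdisj, ← Finset.Ico_insert_right hzx,
    Finset.sum_insert Finset.right_notMem_Ico, add_comm (f x)]

theorem sum_Icc_one_eq_sum_range {M : Type*} [AddCommMonoid M] (n : ℕ) (f : ℕ → M) :
    ∑ l ∈ Finset.Icc 1 n, f l = ∑ l ∈ Finset.range n, f (l + 1) := by
  rw [Finset.range_eq_Ico, Finset.sum_Ico_add', zero_add, Finset.Ico_add_one_right_eq_Icc]

theorem sum_Ico_zero_eq {M : Type*} [AddCommMonoid M] {x : ℤ} (hx : 0 < x) (f : ℤ → M) :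
    ∑ j ∈ Finset.Ico 0 x, f j = f 0 + ∑ j ∈ Finset.Icc 1 (x - 1), f j := by
  rw [← Finset.Ioo_insert_left hx, Finset.sum_insert Finset.left_notMem_Ioo,
    ← Finset.Icc_add_one_sub_one_eq_Ioo, zero_add]

theorem prod_Ico_one_eq_prod_fin {M : Type*} [CommMonoid M] (n : ℕ) (f : ℕ → M) :
    ∏ x ∈ Finset.Ico 1 (n + 1), f x = ∏ i : Fin n, f (i + 1) := by
  rw [Finset.prod_Ico_eq_prod_range, Nat.add_sub_cancel, ← Fin.prod_univ_eq_prod_range]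
  simp only [add_comm]

theorem sum_Ioo_sub_natCast {M : Type*} [AddCommMonoid M] (f : ℤ → M) (K : ℤ) (c : ℕ) :
    ∑ x ∈ Finset.Ioo (K - c) K, f x = ∑ l ∈ Finset.Ico 1 c, f (K - l) := by
  refine Finset.sum_nbij' (fun x => (K - x).toNat) (fun l => K - l) ?_ ?_ ?_ ?_ ?_
  all_goals
    intro x hx
    simp only [Finset.mem_Ioo, Finset.mem_Ico] at hx ⊢
  · omega
  · omega
  · omega
  · omega
  · rw [Int.toNat_of_nonneg (by omega), sub_sub_cancel]

theorem sum_mul_sum_Ioo_comm [LinearOrder ι] [LocallyFiniteOrder ι] (z x : ι) (c I : ι → R) :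
    ∑ j ∈ Finset.Ico z x, c j * ∑ l ∈ Finset.Ioo j x, I l =
      ∑ l ∈ Finset.Ico z x, (∑ j ∈ Finset.Ico z l, c j) * I l := by
  simp only [Finset.mul_sum, Finset.sum_mul]
  refine Finset.sum_comm' fun j l => ?_
  simp only [Finset.mem_Ico, Finset.mem_Ioo]
  constructor
  · rintro ⟨⟨hzj, -⟩, hjl, hlx⟩
    exact ⟨⟨hzj, hjl⟩, hzj.trans hjl.le, hlx⟩
  · rintro ⟨⟨hzj, hjl⟩, -, hlx⟩
    exact ⟨⟨hzj, hjl.trans hlx⟩, hjl, hlx⟩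

/-- The map `I ↦ J` is affine with a triangular linear part, and `c ↦ c'` is the transpose of that
linear part. -/
theorem sum_mul_eq_sum_transpose_mul [LinearOrder ι] [LocallyFiniteOrder ι] {z x w : ι}
    (hzx : z ≤ x) (hxw : x ≤ w) {d c c' I J : ι → R} {a a' e κ : R}
    (hJ : ∀ j < x, J j = d j * I j + a * ∑ l ∈ Finset.Ioo j x, I l + a' * I x + κ)
    (hJ' : ∀ j, x ≤ j → J j = e * I j + κ)
    (hc : ∀ j, z ≤ j → j < x → c' j = d j * c j + a * ∑ l ∈ Finset.Ico z j, c l)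
    (hcx : c' x = a' * ∑ l ∈ Finset.Ico z x, c l + e * c x)
    (hc' : ∀ j, x < j → c' j = e * c j) :
    ∑ j ∈ Finset.Icc z w, c j * J j =
      ∑ j ∈ Finset.Icc z w, c' j * I j + κ * ∑ j ∈ Finset.Icc z w, c j := by
  have hbelow : ∑ j ∈ Finset.Ico z x, c j * J j = ∑ j ∈ Finset.Ico z x, c' j * I j
      + a' * (∑ l ∈ Finset.Ico z x, c l) * I x + κ * ∑ j ∈ Finset.Ico z x, c j := calc
    _ = ∑ j ∈ Finset.Ico z x, d j * c j * I j
        + a * ∑ j ∈ Finset.Ico z x, c j * ∑ l ∈ Finset.Ioo j x, I l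
        + a' * (∑ l ∈ Finset.Ico z x, c l) * I x + κ * ∑ j ∈ Finset.Ico z x, c j := by
      simp only [Finset.mul_sum _ _ a, Finset.mul_sum _ _ a', Finset.mul_sum _ _ κ, Finset.sum_mul,
        ← Finset.sum_add_distrib]
      refine Finset.sum_congr rfl fun j hj => ?_
      rw [hJ j (Finset.mem_Ico.1 hj).2]
      ring
    _ = _ := by
      rw [sum_mul_sum_Ioo_comm, Finset.mul_sum, ← Finset.sum_add_distrib]
      congr 2
      refine Finset.sum_congr rfl fun j hj => ?_
      rw [hc j (Finset.mem_Ico.1 hj).1 (Finset.mem_Ico.1 hj).2]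
      ring
  have habove : ∑ j ∈ Finset.Ioc x w, c j * J j =
      ∑ j ∈ Finset.Ioc x w, c' j * I j + κ * ∑ j ∈ Finset.Ioc x w, c j := by
    rw [Finset.mul_sum, ← Finset.sum_add_distrib]
    refine Finset.sum_congr rfl fun j hj => ?_
    rw [hJ' j (Finset.mem_Ioc.1 hj).1.le, hc' j (Finset.mem_Ioc.1 hj).1]
    ring
  simp only [sum_Icc_eq_sum_Ico_add_sum_Ioc hzx hxw]
  rw [hbelow, habove, hcx, hJ' x le_rfl]
  ring

theorem sum_powersetCard_succ_insert_prod_mul_prod_sdiff [DecidableEq ι] {i : ι} {s : Finset ι}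
    (hi : i ∉ s) (l : ℕ) (f g : ι → R) :
    ∑ T ∈ (insert i s).powersetCard (l + 1), (∏ k ∈ T, f k) * ∏ k ∈ insert i s \ T, g k =
      g i * ∑ T ∈ s.powersetCard (l + 1), (∏ k ∈ T, f k) * ∏ k ∈ s \ T, g k
        + f i * ∑ T ∈ s.powersetCard l, (∏ k ∈ T, f k) * ∏ k ∈ s \ T, g k := by
  have hnotMem {n : ℕ} {T : Finset ι} (hT : T ∈ s.powersetCard n) : i ∉ T :=
    fun h => hi ((Finset.mem_powersetCard.1 hT).1 h)
  have hdisj : Disjoint (s.powersetCard (l + 1)) ((s.powersetCard l).image (insert i)) := by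
    refine Finset.disjoint_left.2 fun T hT hT' => ?_
    obtain ⟨U, -, rfl⟩ := Finset.mem_image.1 hT'
    exact hnotMem hT (Finset.mem_insert_self _ _)
  have hinj : Set.InjOn (insert i) (s.powersetCard l : Set (Finset ι)) := fun T hT U hU heq => by
    rw [← Finset.erase_insert (hnotMem hT), ← Finset.erase_insert (hnotMem hU), heq]
  rw [Finset.powersetCard_succ_insert hi, Finset.sum_union hdisj, Finset.sum_image hinj,
    Finset.mul_sum, Finset.mul_sum]
  congr 1 <;> refine Finset.sum_congr rfl fun T hT => ?_
  · rw [Finset.insert_sdiff_of_notMem _ (hnotMem hT),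
      Finset.prod_insert fun h => hi (Finset.mem_sdiff.1 h).1]
    ring
  · rw [Finset.prod_insert (hnotMem hT), Finset.insert_sdiff_insert,
      Finset.sdiff_insert_of_notMem hi]
    ring

end FinsetSums

section ProductExpansions

variable {ι R : Type*} [CommRing R]

theorem prod_const_sub_eq_sum_powersetCard (S : Finset ι) (x : R) (f : ι → R) :
    ∏ q ∈ S, (x - f q) = x ^ S.card + ∑ l ∈ Finset.Icc 1 S.card,
      (-1) ^ l * x ^ (S.card - l) * ∑ T ∈ S.powersetCard l, ∏ q ∈ T, f q := by
  have hexpand : ∏ q ∈ S, (x - f q) = ∑ l ∈ Finset.range (S.card + 1),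
      (-1) ^ l * x ^ (S.card - l) * ∑ T ∈ S.powersetCard l, ∏ q ∈ T, f q := by
    classical
    simp_rw [sub_eq_neg_add, Finset.prod_add, Finset.sum_powerset, Finset.mul_sum]
    refine Finset.sum_congr rfl fun l _ => Finset.sum_congr rfl fun T hT => ?_
    obtain ⟨hTS, hcard⟩ := Finset.mem_powersetCard.1 hT
    rw [Finset.prod_neg, Finset.prod_const, Finset.card_sdiff_of_subset hTS, hcard]
    ring
  rw [hexpand, Finset.range_eq_Ico, Finset.sum_eq_sum_Ico_succ_bot (by omega),
    Finset.Ico_add_one_right_eq_Icc]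
  simp

variable [DecidableEq ι]

theorem prod_add_eq_sum_proper_add (T : Finset ι) (hT : T.Nonempty) (f g : ι → R) :
    ∏ q ∈ T, (f q + g q) =
      ∑ U ∈ T.powerset.filter (fun U => U ≠ ∅ ∧ U ≠ T), (∏ q ∈ U, f q) * ∏ q ∈ T \ U, g q
        + ∏ q ∈ T, f q + ∏ q ∈ T, g q := by
  have hfilter : T.powerset.filter (fun U => U ≠ ∅ ∧ U ≠ T) = (T.powerset.erase ∅).erase T := by
    ext U
    simp only [Finset.mem_filter, Finset.mem_erase]
    tauto
  have hmem : T ∈ T.powerset.erase ∅ := Finset.mem_erase.2 ⟨hT.ne_empty, Finset.mem_powerset_self T⟩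
  rw [hfilter, Finset.prod_add, ← Finset.sum_erase_add _ _ (Finset.empty_mem_powerset T),
    ← Finset.sum_erase_add _ _ hmem, Finset.prod_empty, Finset.sdiff_empty, Finset.sdiff_self,
    Finset.prod_empty, one_mul, mul_one]

theorem filter_proper_eq_empty_of_card_eq_one {T : Finset ι} (hT : T.card = 1) :
    T.powerset.filter (fun U => U ≠ ∅ ∧ U ≠ T) = ∅ := by
  obtain ⟨q, rfl⟩ := Finset.card_eq_one.1 hT
  refine Finset.filter_eq_empty_iff.2 fun U hU => ?_
  have := Finset.subset_singleton_iff.1 (Finset.mem_powerset.1 hU)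
  tauto

theorem prod_const_sub_add_eq (S : Finset ι) (x : R) (f g : ι → R) :
    ∏ q ∈ S, (x - (f q + g q)) =
      ∑ l ∈ Finset.Icc 2 S.card, (-1) ^ l *
          (∑ T ∈ S.powersetCard l, ∑ U ∈ T.powerset.filter (fun U => U ≠ ∅ ∧ U ≠ T),
            (∏ q ∈ U, f q) * ∏ q ∈ T \ U, g q) * x ^ (S.card - l)
        + ∏ q ∈ S, (x - f q) + ∏ q ∈ S, (x - g q) - x ^ S.card := by
  have hone : ∀ l ∈ Finset.Icc 1 S.card, l ∉ Finset.Icc 2 S.card → (-1) ^ l *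
      (∑ T ∈ S.powersetCard l, ∑ U ∈ T.powerset.filter (fun U => U ≠ ∅ ∧ U ≠ T),
        (∏ q ∈ U, f q) * ∏ q ∈ T \ U, g q) * x ^ (S.card - l) = 0 := by
    intro l hl hl'
    obtain rfl : l = 1 := by
      rw [Finset.mem_Icc] at hl hl'
      omega
    rw [Finset.sum_eq_zero fun T hT => by
      rw [filter_proper_eq_empty_of_card_eq_one (Finset.mem_powersetCard.1 hT).2,
        Finset.sum_empty], mul_zero, zero_mul]
  have hsplit : ∀ l ∈ Finset.Icc 1 S.card, ∑ T ∈ S.powersetCard l, ∏ q ∈ T, (f q + g q) =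
      (∑ T ∈ S.powersetCard l, ∑ U ∈ T.powerset.filter (fun U => U ≠ ∅ ∧ U ≠ T),
        (∏ q ∈ U, f q) * ∏ q ∈ T \ U, g q)
      + ∑ T ∈ S.powersetCard l, ∏ q ∈ T, f q + ∑ T ∈ S.powersetCard l, ∏ q ∈ T, g q := by
    intro l hl
    rw [← Finset.sum_add_distrib, ← Finset.sum_add_distrib]
    refine Finset.sum_congr rfl fun T hT => prod_add_eq_sum_proper_add T ?_ f g
    rw [← Finset.card_pos, (Finset.mem_powersetCard.1 hT).2]
    exact (Finset.mem_Icc.1 hl).1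
  rw [Finset.sum_subset (Finset.Icc_subset_Icc_left one_le_two) hone]
  simp only [prod_const_sub_eq_sum_powersetCard]
  rw [Finset.sum_congr rfl fun l hl => by rw [hsplit l hl, mul_add, mul_add],
    Finset.sum_add_distrib, Finset.sum_add_distrib]
  simp only [mul_right_comm]
  ring

end ProductExpansions

/-! ### The iterative formula -/

theorem val_lt_card_filter_iff {m : ℕ} {P : Fin m → Prop} [DecidablePred P] (hP : Antitone P)
    (i : Fin m) : (i : ℕ) < (Finset.univ.filter P).card ↔ P i := by
  constructor
  · contrapose!
    intro hi
    have hsub : Finset.univ.filter P ⊆ Finset.Iio i := fun j hj =>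
      Finset.mem_Iio.2 (lt_of_not_ge fun hij => hi (hP hij (Finset.mem_filter_univ j |>.1 hj)))
    simpa using Finset.card_le_card hsub
  · intro hi
    have hsub : Finset.Iic i ⊆ Finset.univ.filter P := fun j hj =>
      Finset.mem_filter_univ j |>.2 (hP (Finset.mem_Iic.1 hj) hi)
    simpa [Nat.succ_le_iff] using Finset.card_le_card hsub

theorem sub_ediv_le_sub_ediv {a a' b b' q : ℤ} (ha : 0 < a) (haa' : a ≤ a') (hb : 0 ≤ b)
    (hb' : 0 ≤ b') (hbb' : a = a' → b ≤ b') (hq : b + a * b ≤ q) :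
    (q - b') / a' ≤ (q - b) / a := by
  obtain rfl | hlt := haa'.eq_or_lt
  · exact Int.ediv_le_ediv ha (by linarith [hbb' rfl])
  rw [Int.le_ediv_iff_mul_le ha]
  set K := (q - b') / a'
  have hK : K * a' ≤ q - b' := Int.ediv_mul_le _ (ha.trans hlt).ne'
  -- If `K < b` the hypothesis on `q` applies; otherwise `a' ≥ a + 1` wins `K ≥ b` over `a`.
  obtain hKb | hbK := le_or_gt K b
  · linarith [mul_le_mul_of_nonneg_right hKb ha.le]
  · have : K * (a + 1) ≤ K * a' := mul_le_mul_of_nonneg_left hlt (hb.trans hbK.le)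
    linarith

namespace Exponents

variable {m : ℕ} (B : Exponents m) (Q : ℕ)

/-- The exponent in `[2]` of the variable at position `j`; it is `0` if there is no such
variable. -/
def exp₂ (j : ℕ) : ℕ := if h : j < m then B.e₂ ⟨j, h⟩ else 0

/-- The exponent in `[1]` of the variable at position `j`; it is `0` if there is no such
variable. -/
def exp₁ (j : ℕ) : ℕ := if h : j < m then B.e₁ ⟨j, h⟩ else 0

theorem expMax_eq (j : ℕ) : B.expMax j = max (B.exp₂ j : ℤ) (B.exp₁ j) := by
  unfold expMax exp₂ exp₁
  split_ifs <;> simp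

theorem expMin_eq (j : ℕ) : B.expMin j = min (B.exp₂ j : ℤ) (B.exp₁ j) := by
  unfold expMin exp₂ exp₁
  split_ifs <;> simp

theorem diff_eq (j : ℕ) : B.diff j = (B.exp₁ j : ℤ) - B.exp₂ j := by
  unfold diff exp₂ exp₁ Δ
  split_ifs <;> simp

theorem r_add_s_eq : B.r + B.s = (Finset.univ.filter fun i => B.Δ i ≤ 0).card := by
  rw [r, s, ← Finset.card_union_of_disjoint
    (Finset.disjoint_filter.2 fun _ _ hlt => hlt.ne), ← Finset.filter_or]
  simp only [le_iff_lt_or_eq]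

theorem r_add_s_add_t : B.r + B.s + B.t = m := by
  have hle : B.r + B.s ≤ m :=
    B.r_add_s_eq ▸ (Finset.card_le_univ _).trans_eq (Fintype.card_fin m)
  unfold t
  omega

variable {B Q}

section Sign

variable {j : ℕ} (hΔ : Monotone B.Δ)
include hΔ

theorem lt_r_iff (hj : j < m) : j < B.r ↔ B.exp₁ j < B.exp₂ j := by
  have hcard := val_lt_card_filter_iff (P := fun i => B.Δ i < 0)
    (fun _ _ hle hlt => (hΔ hle).trans_lt hlt) ⟨j, hj⟩
  rw [r, exp₁, exp₂, dif_pos hj, dif_pos hj]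
  exact hcard.trans (by simp [Δ])

theorem lt_r_add_s_iff (hj : j < m) : j < B.r + B.s ↔ B.exp₁ j ≤ B.exp₂ j := by
  have hcard := val_lt_card_filter_iff (P := fun i => B.Δ i ≤ 0)
    (fun _ _ hle hle' => (hΔ hle).trans hle') ⟨j, hj⟩
  rw [r_add_s_eq, exp₁, exp₂, dif_pos hj, dif_pos hj]
  exact hcard.trans (by simp [Δ])

theorem exp₁_lt_exp₂ (hj : j < B.r) : B.exp₁ j < B.exp₂ j := by
  have hm := B.r_add_s_add_t
  exact (lt_r_iff hΔ (by omega)).1 hj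

theorem exp₂_eq_exp₁ (hj : B.r ≤ j) (hj' : j < B.r + B.s) : B.exp₂ j = B.exp₁ j := by
  have hm := B.r_add_s_add_t
  have hneg := lt_r_iff hΔ (j := j) (by omega)
  have hnonpos := lt_r_add_s_iff hΔ (j := j) (by omega)
  omega

theorem exp₂_lt_exp₁ (hj : B.r + B.s ≤ j) (hj' : j < m) : B.exp₂ j < B.exp₁ j := by
  have hnonpos := lt_r_add_s_iff hΔ hj'
  omega

end Sign

theorem Admissible.exp₁_le (h : B.Admissible Q) (j : ℕ) : B.exp₁ j ≤ Q := by
  unfold exp₁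
  split_ifs
  · exact h.2.1 _
  · exact Q.zero_le

variable (B Q) in
/-- The chain count of `startCount` in the last `l` of the variables. -/
noncomputable def lastCount (l c : ℕ) : ℤ :=
  startCount (fun i : Fin l => B.exp₂ (m - l + i)) (fun i : Fin l => B.exp₁ (m - l + i)) Q c

section LastCount

variable {c j l : ℕ}

theorem lastCount_card : B.lastCount Q m c = startCount B.e₂ B.e₁ Q c := by
  simp [lastCount, exp₁, exp₂]

theorem lastCount_zero (h : B.Admissible Q) :
    B.lastCount Q l 0 = (Q : ℤ) ^ l - ∏ i : Fin l, ((Q : ℤ) - B.exp₁ (m - l + i)) :=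
  startCount_zero fun _ => h.exp₁_le _

theorem tail_comp_position (e : ℕ → ℕ) (hj : j + l + 1 = m) :
    Fin.tail (fun i : Fin (l + 1) => e (m - (l + 1) + i)) = fun i : Fin l => e (m - l + i) := by
  funext i
  simp only [Fin.tail, Fin.val_succ]
  congr 1
  omega

theorem lastCount_zero_succ (h : B.Admissible Q) (hj : j + l + 1 = m) :
    B.lastCount Q (l + 1) 0 =
      (Q - B.exp₁ j) * B.lastCount Q l 0 + B.exp₁ j * (Q : ℤ) ^ l := by
  have hprod (i : Fin l) : m - (l + 1) + (i.succ : ℕ) = m - l + i := by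
    rw [Fin.val_succ]
    omega
  have hfirst : m - (l + 1) + ((0 : Fin (l + 1)) : ℕ) = j := by
    rw [Fin.val_zero]
    omega
  rw [lastCount_zero h, lastCount_zero h, Fin.prod_univ_succ, hfirst]
  simp only [hprod]
  ring

theorem lastCount_succ_of_eq (h : B.Admissible Q) (hj : j + l + 1 = m)
    (heq : B.exp₂ j = B.exp₁ j) : B.lastCount Q (l + 1) c =
      (Q - B.exp₁ j) * B.lastCount Q l c + B.exp₁ j * (Q : ℤ) ^ l := by
  obtain rfl : j = m - (l + 1) := by omega
  have hstep := startCount_succ_of_eq (c := c)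
    (u := fun i : Fin (l + 1) => B.exp₂ (m - (l + 1) + i))
    (v := fun i => B.exp₁ (m - (l + 1) + i)) heq (h.exp₁_le _)
  rwa [tail_comp_position _ hj, tail_comp_position _ hj] at hstep

theorem lastCount_succ_of_lt (h : B.Admissible Q) (hj : j + l + 1 = m)
    (hlt : B.exp₁ j < B.exp₂ j) (hc : (B.exp₂ j - B.exp₁ j) * c ≤ Q - B.exp₁ j) :
    B.lastCount Q (l + 1) c = B.exp₁ j * (Q : ℤ) ^ l
      + ((B.exp₂ j : ℤ) - B.exp₁ j) * ∑ x ∈ Finset.range c, B.lastCount Q l x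
      + (Q - B.exp₁ j - ((B.exp₂ j : ℤ) - B.exp₁ j) * c) * B.lastCount Q l c := by
  obtain rfl : j = m - (l + 1) := by omega
  have hstep := startCount_succ_of_lt (u := fun i : Fin (l + 1) => B.exp₂ (m - (l + 1) + i))
    (v := fun i => B.exp₁ (m - (l + 1) + i)) hlt (h.exp₁_le _) hc
  rwa [tail_comp_position _ hj, tail_comp_position _ hj] at hstep

end LastCount

variable {i : ℕ}

section NegativeVariables

variable (B Q) in
/-- The largest number of steps that a chain starting in the box `[0, Q)^m` can take before the
exponent of `N_i` becomes too small; it is the paper's `M_{a_i} - p_{a_i}`. -/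
def maxSteps (i : ℕ) : ℤ := ((Q : ℤ) - 1 - B.b i) / B.a i

variable (B Q) in
/-- The paper's `K_i`, the contribution to the count of the starting points in which the exponent
of `N_i` is too small for a step. -/
def Kconst (i : ℕ) : ℤ :=
  (B.NMax i - B.NMin i) * B.GN Q i + B.NMin i * (Q : ℤ) ^ (B.s + B.t + i - 1)

theorem b_nonneg : 0 ≤ B.b i := by
  rw [b, NMin, expMin_eq]
  omega

theorem y_spec (ha : 0 < B.a i) (hpos : 0 < B.b i - B.rem Q i) :
    B.a i ∣ B.y Q i ∧ B.b i - B.rem Q i ≤ B.y Q i ∧ B.y Q i < B.b i - B.rem Q i + B.a i := by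
  set S := {z : ℕ | 0 < z ∧ B.b i - B.rem Q i ≤ z ∧ B.a i ∣ z}
  obtain ⟨a, ha'⟩ := Int.eq_ofNat_of_zero_le ha.le
  obtain ⟨x, hx⟩ := Int.eq_ofNat_of_zero_le hpos.le
  have hne : S.Nonempty := by
    refine ⟨x * a, Nat.mul_pos (by omega) (by omega), ?_, by simp [ha']⟩
    rw [hx, Nat.cast_le]
    exact Nat.le_mul_of_pos_right _ (by omega)
  obtain ⟨-, hle, hdvd⟩ := Nat.sInf_mem hne
  refine ⟨hdvd, hle, lt_of_not_ge fun hge => ?_⟩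
  change _ ≤ ((sInf S : ℕ) : ℤ) at hge
  have hsub : sInf S - a ∈ S := by
    refine ⟨by omega, by omega, ?_⟩
    rw [Nat.cast_sub (by omega), ← ha']
    exact dvd_sub_self_right.2 hdvd
  have hmin := Nat.sInf_le hsub
  omega

theorem E_spec (ha : 0 < B.a i) :
    B.E Q i = B.rem Q i - B.b i + B.a i * B.pa Q i ∧ 0 ≤ B.E Q i ∧ B.E Q i < B.a i := by
  have hb := B.b_nonneg (i := i)
  have hrem_nonneg : 0 ≤ B.rem Q i := Int.emod_nonneg _ ha.ne'
  have hrem_lt : B.rem Q i < B.a i := Int.emod_lt_of_pos _ ha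
  obtain hba | hba := lt_or_ge (B.b i) (B.a i)
  · by_cases hbr : B.b i ≤ B.rem Q i
    · have hp : B.pa Q i = 0 := by rw [pa, if_pos hba, if_pos hbr]
      rw [E, if_pos hp, hp]
      omega
    · have hp : B.pa Q i = 1 := by rw [pa, if_pos hba, if_neg hbr]
      rw [E, if_neg (by omega), if_pos hp, hp]
      omega
  · obtain ⟨hdvd, hle, hlt⟩ := B.y_spec (Q := Q) ha (by omega)
    have hy : B.a i * B.pa Q i = B.y Q i := by
      rw [pa, if_neg hba.not_gt, qa, Int.mul_ediv_cancel' hdvd]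
    have hE : B.E Q i = B.rem Q i - B.b i + B.a i * B.pa Q i := by
      rw [E]
      split_ifs with hp₀ hp₁
      · simp [hp₀]
      · simp [hp₁]
      · rw [hy]
        ring
    omega

theorem maxSteps_eq_and_E_eq (ha : 0 < B.a i) :
    B.maxSteps Q i = B.Mq Q i - B.pa Q i ∧ ((Q : ℤ) - 1 - B.b i) % B.a i = B.E Q i := by
  obtain ⟨hE, hE_nonneg, hE_lt⟩ := E_spec (Q := Q) ha
  refine (Int.ediv_emod_unique ha).2 ⟨?_, hE_nonneg, hE_lt⟩
  have hdiv : B.a i * B.Mq Q i + B.rem Q i = (Q : ℤ) - 1 := Int.mul_ediv_add_emod _ _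
  linear_combination hE + hdiv

theorem E_eq (ha : 0 < B.a i) :
    B.E Q i = (Q : ℤ) - 1 - B.b i - B.a i * B.maxSteps Q i := by
  rw [← (maxSteps_eq_and_E_eq ha).2, Int.emod_def, maxSteps]

theorem mul_maxSteps_le (ha : 0 < B.a i) : B.a i * B.maxSteps Q i ≤ (Q : ℤ) - 1 - B.b i :=
  Int.mul_ediv_self_le ha.ne'

section Order

variable (hΔ : Monotone B.Δ) (hi : 1 ≤ i) (hir : i ≤ B.r)
include hΔ hi hir

theorem b_eq : B.b i = B.exp₁ (B.r - i) := by
  have hlt := exp₁_lt_exp₂ hΔ (j := B.r - i) (by omega)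
  rw [b, NMin, expMin_eq]
  omega

theorem NMax_eq : B.NMax i = B.a i + B.b i := by
  have hlt := exp₁_lt_exp₂ hΔ (j := B.r - i) (by omega)
  rw [b_eq hΔ hi hir, NMax, expMax_eq, a, diff_eq]
  omega

theorem a_pos : 0 < B.a i := by
  have hlt := exp₁_lt_exp₂ hΔ (j := B.r - i) (by omega)
  rw [a, diff_eq]
  omega

theorem kLast_eq : B.kLast Q i = max 1 (B.maxSteps Q i - 1) := by
  have ha := a_pos hΔ hi hir
  have hnum : (Q : ℤ) - B.NMax i - 1 - B.E Q i = (B.maxSteps Q i - 1) * B.a i := by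
    rw [NMax_eq hΔ hi hir, E_eq ha]
    ring
  rw [kLast, hnum, leastPos, Int.cast_mul, mul_div_cancel_right₀ _ (Int.cast_ne_zero.2 ha.ne'),
    Int.ceil_intCast]

theorem a'_eq : B.a' Q i = B.a i * (B.maxSteps Q i - B.kLast Q i) := by
  rw [a', NMax_eq hΔ hi hir, E_eq (a_pos hΔ hi hir)]
  ring

theorem Da_eq : B.Da Q i = Q - B.b i - B.a i * B.maxSteps Q B.r := by
  have ha := a_pos hΔ hi hir
  rw [Da, (maxSteps_eq_and_E_eq (a_pos hΔ (hi.trans hir) le_rfl)).1, E_eq ha,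
    (maxSteps_eq_and_E_eq ha).1]
  ring

theorem Xlast_eq : B.Xlast Q i = B.maxSteps Q B.r - B.maxSteps Q i + B.kLast Q i := by
  rw [Xlast, (maxSteps_eq_and_E_eq (a_pos hΔ hi hir)).1,
    (maxSteps_eq_and_E_eq (a_pos hΔ (hi.trans hir) le_rfl)).1]
  ring

theorem Admissible.maxSteps_le (h : B.Admissible Q) : B.maxSteps Q B.r ≤ B.maxSteps Q i := by
  rw [(maxSteps_eq_and_E_eq (a_pos hΔ hi hir)).1,
    (maxSteps_eq_and_E_eq (a_pos hΔ (hi.trans hir) le_rfl)).1]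
  exact h.2.2 i hi hir

theorem Admissible.one_le_maxSteps (h : B.Admissible Q) : 1 ≤ B.maxSteps Q i := by
  have hm := B.r_add_s_add_t
  have hlt : (B.exp₂ (B.r - i) : ℤ) < Q := by
    rw [exp₂, dif_pos (by omega)]
    exact_mod_cast h.1 _
  have hmax := NMax_eq hΔ hi hir
  rw [NMax, expMax_eq, max_eq_left (by exact_mod_cast (exp₁_lt_exp₂ hΔ (by omega)).le)] at hmax
  rw [maxSteps, Int.le_ediv_iff_mul_le (a_pos hΔ hi hir)]
  omega

end Order

end NegativeVariables

section PositiveVariables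

variable (B Q)

theorem mul_Cq_succ {q : ℕ} (hq : q ≤ B.t) : (Q : ℤ) * B.Cq Q (q + 1) = B.Cq Q q := by
  rw [Cq, Cq, ← pow_succ', Nat.add_sub_add_right, Nat.sub_add_comm hq]

theorem Aq_eq {q : ℕ} (hq : q ≤ B.t + 1) :
    B.Aq Q q = B.Cq Q q - ∏ x ∈ Finset.Ico q (B.t + 1), ((Q : ℤ) - B.PMin x) := by
  induction hq using Nat.decreasingInduction with
  | self => rw [Aq, if_pos B.t.lt_succ_self, Cq]; simp
  | of_succ q hq ih =>
    rw [Aq, if_neg (by omega), ih, Finset.prod_eq_prod_Ico_succ_bot hq,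
      ← mul_Cq_succ B Q (Nat.lt_succ_iff.1 hq)]
    ring

theorem Dq_eq (M : ℤ) {q : ℕ} (hq : q ≤ B.t + 1) :
    B.Dq Q M q = B.Aq Q q
      + ∏ x ∈ Finset.Ico q (B.t + 1), ((Q : ℤ) - B.PMin x - B.minc Q M x) := by
  induction hq using Nat.decreasingInduction with
  | self => rw [Dq, if_pos B.t.lt_succ_self, Aq, if_pos B.t.lt_succ_self]; simp
  | of_succ q hq ih =>
    rw [Dq, if_neg (by omega), ih, Aq.eq_def B Q q, if_neg (by omega),
      Finset.prod_eq_prod_Ico_succ_bot hq]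
    ring

theorem hP_eq (M : ℤ) (q : ℕ) :
    B.hP Q M q = max 0 (Q - B.minc Q M q - B.PMax q) := by
  rw [hP]
  split_ifs <;> omega

theorem hP_add_dP (M : ℤ) (q : ℕ) :
    B.hP Q M q + B.dP Q M q = Q - B.PMin q - B.minc Q M q := by
  rw [hP_eq, dP, sP]
  omega

theorem PMin_le_PMax (q : ℕ) : B.PMin q ≤ B.PMax q := by
  rw [PMin, PMax, expMin_eq, expMax_eq]
  exact min_le_max

theorem hP_eq_zero (M : ℤ) {q : ℕ} (hq : B.minc Q M q = Q - B.PMin q) : B.hP Q M q = 0 := by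
  have hle := B.PMin_le_PMax q
  rw [hP_eq]
  omega

theorem Dtilde_eq (M : ℤ) {q : ℕ} (hq : q ≤ B.t + 1) :
    B.Dtilde Q M q = B.Dq Q M q - ∏ x ∈ Finset.Ico q (B.t + 1), B.hP Q M x := by
  induction hq using Nat.decreasingInduction with
  | self => rw [Dtilde, if_pos B.t.lt_succ_self, Dq, if_pos B.t.lt_succ_self]; simp
  | of_succ q hq ih =>
    have hqt : ¬ B.t < q := by omega
    rw [Dtilde, if_neg hqt, ih, Dq.eq_def B Q M q, if_neg hqt, Finset.prod_eq_prod_Ico_succ_bot hq]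
    split_ifs with hlt
    · linear_combination B.Dq Q M (q + 1) * B.hP_add_dP Q M q
    · have hmin : B.minc Q M q = Q - B.PMin q := by
        rw [minc] at hlt ⊢
        omega
      rw [hP_eq_zero B Q M hmin, hmin]
      ring

theorem frakS_zero (M : ℤ) : B.frakS Q M 0 = B.Dtilde Q M 1 := by
  by_cases ht : B.t = 0
  · rw [frakS, Dtilde, if_pos ht, if_pos (by omega)]
  · rw [frakS, Dtilde, if_neg ht, if_neg (by omega), BP]
    split_ifs <;> ring

theorem frakS_zero_eq (M : ℤ) : B.frakS Q M 0 = (Q : ℤ) ^ B.t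
    - ∏ x ∈ Finset.Ico 1 (B.t + 1), ((Q : ℤ) - B.PMin x)
    + ∏ x ∈ Finset.Ico 1 (B.t + 1), ((Q : ℤ) - B.PMin x - B.minc Q M x)
    - ∏ x ∈ Finset.Ico 1 (B.t + 1), B.hP Q M x := by
  have ht : 1 ≤ B.t + 1 := by omega
  rw [frakS_zero, Dtilde_eq B Q M ht, Dq_eq B Q M ht, Aq_eq B Q ht, Cq, Nat.add_sub_cancel]

variable {B Q}

section Order

variable (hΔ : Monotone B.Δ) {q : ℕ} (hq : q < B.t)
include hΔ hq

theorem PMin_succ : B.PMin (q + 1) = B.exp₂ (B.r + B.s + q) := by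
  have hm := B.r_add_s_add_t
  have hlt := exp₂_lt_exp₁ hΔ (j := B.r + B.s + q) (by omega) (by omega)
  rw [PMin, ← add_assoc, Nat.add_sub_cancel, expMin_eq]
  omega

theorem PMax_succ : B.PMax (q + 1) = B.exp₁ (B.r + B.s + q) := by
  have hm := B.r_add_s_add_t
  have hlt := exp₂_lt_exp₁ hΔ (j := B.r + B.s + q) (by omega) (by omega)
  rw [PMax, ← add_assoc, Nat.add_sub_cancel, expMax_eq]
  omega

end Order

theorem sub_PMin_sub_minc (M : ℤ) (q : ℕ) :
    (Q : ℤ) - B.PMin q - B.minc Q M q = max 0 (Q - M * B.ΔP q - B.PMin q) := by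
  rw [minc]
  omega

theorem hP_eq_max (M : ℤ) (q : ℕ) :
    B.hP Q M q = max 0 (Q - M * B.ΔP q - B.PMax q) := by
  have hle := B.PMin_le_PMax q
  rw [hP_eq, minc]
  omega

theorem frakS_zero_eq_lastCount (hΔ : Monotone B.Δ) (h : B.Admissible Q) (c : ℕ) :
    B.frakS Q c 0 = B.lastCount Q B.t c := by
  have hm := B.r_add_s_add_t
  have hpos : m - B.t = B.r + B.s := by omega
  have hcount := startCount_of_le (Q := Q) (c := c)
    (u := fun i : Fin B.t => B.exp₂ (B.r + B.s + i)) (v := fun i => B.exp₁ (B.r + B.s + i))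
    (fun i => (exp₂_lt_exp₁ hΔ (by omega) (by omega)).le) fun _ => h.exp₁_le _
  have hΔP (i : ℕ) : B.ΔP (i + 1) =
      (B.exp₁ (B.r + B.s + i) : ℤ) - B.exp₂ (B.r + B.s + i) := B.diff_eq _
  rw [lastCount, hpos, hcount, frakS_zero_eq]
  simp only [sub_PMin_sub_minc, hP_eq_max, prod_Ico_one_eq_prod_fin, hΔP,
    PMin_succ hΔ (Fin.is_lt _), PMax_succ hΔ (Fin.is_lt _)]

theorem GP_eq_lastCount (hΔ : Monotone B.Δ) (h : B.Admissible Q) {q : ℕ} (hq : q ≤ B.t) :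
    B.GP Q q = B.lastCount Q (B.t - q) 0 := by
  have hm := B.r_add_s_add_t
  induction hq using Nat.decreasingInduction with
  | self => rw [GP, if_pos le_rfl, Nat.sub_self, lastCount_zero h]; simp
  | of_succ q hq ih =>
    obtain ⟨l, hl⟩ : ∃ l, B.t - q = l + 1 := ⟨B.t - q - 1, by omega⟩
    have hl' : B.t - (q + 1) = l := by omega
    rw [GP, if_neg (by omega), ih, hl, hl', lastCount_zero_succ h (j := B.r + B.s + q) (by omega),
      PMax_succ hΔ hq, Nat.add_sub_cancel]

end PositiveVariables

section ZeroVariables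

variable {l : ℕ} (hΔ : Monotone B.Δ) (h : B.Admissible Q) (hl : l ≤ B.s)
include hΔ h hl

theorem frakS_eq_lastCount (c : ℕ) : B.frakS Q c l = B.lastCount Q (B.t + l) c := by
  have hm := B.r_add_s_add_t
  induction l with
  | zero => exact frakS_zero_eq_lastCount hΔ h c
  | succ l ih =>
    have heq := exp₂_eq_exp₁ hΔ (j := B.r + B.s - (l + 1)) (by omega) (by omega)
    rw [← add_assoc, lastCount_succ_of_eq h (by omega) heq, ← ih (by omega), frakS, ZMin,
      expMin_eq, heq, min_self]
    ring

theorem GZ_eq_lastCount : B.GZ Q (l + 1) = B.lastCount Q (B.t + l) 0 := by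
  have hm := B.r_add_s_add_t
  induction l with
  | zero => exact GP_eq_lastCount hΔ h B.t.zero_le
  | succ l ih =>
    have heq := exp₂_eq_exp₁ hΔ (j := B.r + B.s - (l + 1)) (by omega) (by omega)
    rw [← add_assoc, lastCount_zero_succ h (j := B.r + B.s - (l + 1)) (by omega), ← ih (by omega),
      GZ, ZMax, expMax_eq, heq, max_self]

end ZeroVariables

section Iteration

theorem integral_succ_of_lt (hi : 1 ≤ i) {j : ℤ} (hj : j < B.Xlast Q i) :
    B.integral Q (i + 1) j = (B.Da Q i + j * B.a i) * B.integral Q i j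
      + B.a i * ∑ l ∈ Finset.Ioo j (B.Xlast Q i), B.integral Q i l
      + B.a' Q i * B.integral Q i (B.Xlast Q i) + B.Kconst Q i := by
  obtain ⟨i, rfl⟩ := Nat.exists_eq_add_of_le' hi
  rw [integral, if_pos hj, Kconst, Finset.mul_sum, ← add_assoc (B.s + B.t), Nat.add_sub_cancel]
  ring

theorem integral_succ_of_le (hi : 1 ≤ i) {j : ℤ} (hj : B.Xlast Q i ≤ j) :
    B.integral Q (i + 1) j = (Q - B.NMax i) * B.integral Q i j + B.Kconst Q i := by
  obtain ⟨i, rfl⟩ := Nat.exists_eq_add_of_le' hi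
  rw [integral, if_neg hj.not_gt, Kconst, ← add_assoc (B.s + B.t), Nat.add_sub_cancel]
  ring

theorem hkFormula_eq_integral (hr : 1 ≤ B.r) (hX : 0 < B.Xlast Q B.r) :
    B.hkFormula Q = B.integral Q (B.r + 1) 0 := by
  rw [integral_succ_of_lt hr hX, hkFormula, Kconst, Finset.mul_sum]
  ring

theorem integral_succ_eq (hΔ : Monotone B.Δ) (h : B.Admissible Q) (hi : 1 ≤ i) (hir : i ≤ B.r)
    {j : ℤ} (hj : j < B.maxSteps Q B.r) :
    B.integral Q (i + 1) j =
      (Q - B.b i - B.a i * (B.maxSteps Q B.r - j)) * B.integral Q i j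
        + B.a i * ∑ l ∈ Finset.Ioo j (B.maxSteps Q B.r), B.integral Q i l + B.Kconst Q i := by
  have hk := kLast_eq (Q := Q) hΔ hi hir
  have hX := Xlast_eq (Q := Q) hΔ hi hir
  obtain hone | htwo := (h.one_le_maxSteps hΔ hi hir).eq_or_lt
  · have hk' : B.kLast Q i = B.maxSteps Q i := by omega
    have hX' : B.Xlast Q i = B.maxSteps Q B.r := by omega
    rw [integral_succ_of_lt hi (hj.trans_eq hX'.symm), a'_eq hΔ hi hir, Da_eq hΔ hi hir, hk', hX']
    ring
  · have hk' : B.kLast Q i = B.maxSteps Q i - 1 := by omega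
    have hX' : B.Xlast Q i = B.maxSteps Q B.r - 1 := by omega
    obtain hlt | hge := lt_or_ge j (B.Xlast Q i)
    · have hIoo : Finset.Ioo j (B.maxSteps Q B.r) =
          insert (B.Xlast Q i) (Finset.Ioo j (B.Xlast Q i)) := by
        rw [hX'] at hlt ⊢
        ext x
        simp only [Finset.mem_Ioo, Finset.mem_insert]
        omega
      rw [integral_succ_of_lt hi hlt, a'_eq hΔ hi hir, Da_eq hΔ hi hir, hk', hIoo,
        Finset.sum_insert Finset.right_notMem_Ioo]
      ring
    · obtain rfl : j = B.maxSteps Q B.r - 1 := by omega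
      have hIoo : Finset.Ioo (B.maxSteps Q B.r - 1) (B.maxSteps Q B.r) = ∅ := by
        refine Finset.eq_empty_of_forall_notMem fun x hx => ?_
        rw [Finset.mem_Ioo] at hx
        omega
      rw [integral_succ_of_le hi hge, hIoo, Finset.sum_empty, NMax_eq hΔ hi hir]
      ring

theorem GN_eq_lastCount (hΔ : Monotone B.Δ) (h : B.Admissible Q) (hir : i ≤ B.r) :
    B.GN Q (i + 1) = B.lastCount Q (B.t + B.s + i) 0 := by
  have hm := B.r_add_s_add_t
  induction i with
  | zero => exact GZ_eq_lastCount hΔ h le_rfl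
  | succ i ih =>
    rw [← add_assoc, lastCount_zero_succ h (j := B.r - (i + 1)) (by omega), ← ih (by omega), GN,
      ← b, b_eq hΔ (by omega) hir]

theorem integral_eq_lastCount (hΔ : Monotone B.Δ) (h : B.Admissible Q) (hr : 1 ≤ B.r)
    (hir : i ≤ B.r) {c : ℕ} (hc : 1 ≤ c) (hcK : (c : ℤ) ≤ B.maxSteps Q B.r) :
    B.integral Q (i + 1) (B.maxSteps Q B.r - c) = B.lastCount Q (B.t + B.s + i) c := by
  have hm := B.r_add_s_add_t
  induction i generalizing c with
  | zero =>
    rw [integral, ← (maxSteps_eq_and_E_eq (a_pos hΔ hr le_rfl)).1, sub_sub_cancel, Φ]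
    exact frakS_eq_lastCount hΔ h le_rfl c
  | succ i ih =>
    have hi : 1 ≤ i + 1 := by omega
    have hlt := exp₁_lt_exp₂ hΔ (j := B.r - (i + 1)) (by omega)
    have ha := a_pos hΔ hi hir
    have hb := b_eq hΔ hi hir
    have hae : B.a (i + 1) = (B.exp₂ (B.r - (i + 1)) : ℤ) - B.exp₁ (B.r - (i + 1)) := by
      rw [a, diff_eq, neg_sub]
    have hroom : (B.exp₂ (B.r - (i + 1)) - B.exp₁ (B.r - (i + 1))) * c ≤
        Q - B.exp₁ (B.r - (i + 1)) := by
      zify [hlt.le, h.exp₁_le]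
      rw [← hae, ← hb]
      have hle : (c : ℤ) ≤ B.maxSteps Q (i + 1) := hcK.trans (h.maxSteps_le hΔ hi hir)
      have := mul_le_mul_of_nonneg_left hle ha.le
      linarith [mul_maxSteps_le (Q := Q) ha]
    have hsum : ∑ l ∈ Finset.range c, B.lastCount Q (B.t + B.s + i) l = B.GN Q (i + 1)
        + ∑ l ∈ Finset.Ioo (B.maxSteps Q B.r - c) (B.maxSteps Q B.r),
          B.integral Q (i + 1) l := by
      rw [sum_Ioo_sub_natCast, Finset.range_eq_Ico, Finset.sum_eq_sum_Ico_succ_bot hc,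
        GN_eq_lastCount hΔ h (by omega)]
      congr 1
      refine Finset.sum_congr rfl fun l hl => ?_
      rw [Finset.mem_Ico] at hl
      exact (ih (by omega) (by omega) (by omega)).symm
    rw [integral_succ_eq hΔ h hi hir (by omega), sub_sub_cancel, ih (by omega) hc hcK,
      ← add_assoc, lastCount_succ_of_lt h (by omega) hlt hroom, hsum, ← hae, ← hb, Kconst,
      NMax_eq hΔ hi hir, ← b]
    have hexp : B.s + B.t + (i + 1) - 1 = B.t + B.s + i := by omega
    rw [hexp]
    ring

theorem hkFormula_eq_startCount (hΔ : Monotone B.Δ) (hr : 1 ≤ B.r) (h : B.Admissible Q) :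
    B.hkFormula Q = startCount B.e₂ B.e₁ Q (B.maxSteps Q B.r).toNat := by
  have hK := h.one_le_maxSteps hΔ hr le_rfl
  have hX : 0 < B.Xlast Q B.r := by
    rw [Xlast_eq hΔ hr le_rfl, kLast_eq hΔ hr le_rfl]
    omega
  have hm : B.t + B.s + B.r = m := by
    have hm := B.r_add_s_add_t
    omega
  have hcount := integral_eq_lastCount hΔ h hr le_rfl (c := (B.maxSteps Q B.r).toNat)
    (by omega) (by omega)
  rwa [Int.toNat_of_nonneg (by omega), sub_self, hm, lastCount_card,
    ← hkFormula_eq_integral hr hX] at hcount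

theorem exists_hkLength_eq (hΔ : Monotone B.Δ) {k : Type*} [Field k] {c₂ c₁ : k} (hc₂ : c₂ ≠ 0)
    (hc₁ : c₁ ≠ 0) (hr : 1 ≤ B.r) (h : B.Admissible Q) :
    ∃ L : ℕ, hkLength (B.poly c₂ c₁) Q = (L : ℕ∞) ∧ (L : ℤ) = B.hkFormula Q := by
  have hm := B.r_add_s_add_t
  have ha := a_pos hΔ hr le_rfl
  have hΔ₀ : B.a B.r = (B.e₂ ⟨0, by omega⟩ : ℤ) - B.e₁ ⟨0, by omega⟩ := by
    rw [a, diff, Nat.sub_self, dif_pos (by omega), Δ, neg_sub]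
  have hb : B.b B.r = B.e₁ ⟨0, by omega⟩ := by
    rw [b_eq hΔ hr le_rfl, exp₁, Nat.sub_self, dif_pos (by omega)]
  have hK := h.one_le_maxSteps hΔ hr le_rfl
  have hout : (Q : ℤ) - B.e₂ ⟨0, by omega⟩ ≤ (B.maxSteps Q B.r).toNat *
      ((B.e₂ ⟨0, by omega⟩ : ℤ) - B.e₁ ⟨0, by omega⟩) := by
    rw [← hΔ₀, Int.toNat_of_nonneg (by omega)]
    have hE := E_eq (Q := Q) ha
    have hE_lt := (E_spec (Q := Q) ha).2.2
    rw [mul_comm]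
    omega
  refine ⟨Nat.card {β // IsChainStart (Finsupp.equivFunOnFinite.symm B.e₂)
    (Finsupp.equivFunOnFinite.symm B.e₁) Q β}, ?_, ?_⟩
  · exact length_quotient_binomialIdeal (i := ⟨0, by omega⟩) (by
      change B.e₁ _ < B.e₂ _
      omega) hc₂ hc₁
  · rw [hkFormula_eq_startCount hΔ hr h]
    exact natCard_isChainStart hout

end Iteration

/-! ### The expanded form -/

section Expansion

theorem F_succ {l : ℕ} (hl : 1 ≤ l) {j : ℤ} (hj : 1 ≤ j) :
    F (l + 1) j = ∑ i ∈ Finset.Icc 1 (j - 1), F l i + j * F l j := by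
  match l, hl with
  | 1, _ =>
    simp only [F, Finset.sum_const, Int.card_Icc, nsmul_eq_mul, mul_one]
    omega
  | l + 2, _ => rw [F]

theorem H_zero : B.H Q 0 i = ∏ k ∈ Finset.Icc i B.r, B.Da Q k := by
  simp [H]

theorem H_eq_zero {l : ℕ} (h : B.r + 1 < l + i) (hl : 1 ≤ l) : B.H Q l i = 0 := by
  rw [H, Finset.powersetCard_eq_empty.2, Finset.sum_empty]
  rw [Nat.card_Icc]
  omega

theorem H_succ (hi : i ≤ B.r) (l : ℕ) :
    B.H Q (l + 1) i = B.Da Q i * B.H Q (l + 1) (i + 1) + B.a i * B.H Q l (i + 1) := by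
  have hnotMem : i ∉ Finset.Icc (i + 1) B.r := by simp
  simp only [H]
  rw [← Finset.insert_Icc_add_one_left_eq_Icc hi,
    sum_powersetCard_succ_insert_prod_mul_prod_sdiff hnotMem]

theorem sum_F_mul_H_eq (hi : i ≤ B.r) (j : ℤ) :
    ∑ l ∈ Finset.Icc 1 (B.r + 1 - i), F l j * B.H Q l i =
      B.Da Q i * ∑ l ∈ Finset.Icc 1 (B.r - i), F l j * B.H Q l (i + 1)
        + B.a i * (B.H Q 0 (i + 1)
          + ∑ l ∈ Finset.Icc 1 (B.r - i), F (l + 1) j * B.H Q l (i + 1)) := by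
  have htop : ∑ l ∈ Finset.range (B.r - i), F (l + 1) j * B.H Q (l + 1) (i + 1) =
      ∑ l ∈ Finset.range (B.r - i + 1), F (l + 1) j * B.H Q (l + 1) (i + 1) := by
    rw [Finset.sum_range_succ, H_eq_zero (by omega) (by omega), mul_zero, add_zero]
  have hbot : B.H Q 0 (i + 1)
      + ∑ l ∈ Finset.range (B.r - i), F (l + 1 + 1) j * B.H Q (l + 1) (i + 1) =
        ∑ l ∈ Finset.range (B.r - i + 1), F (l + 1) j * B.H Q l (i + 1) := by
    rw [Finset.sum_range_succ', F, one_mul, add_comm]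
  have hlen : B.r + 1 - i = B.r - i + 1 := by omega
  rw [hlen, sum_Icc_one_eq_sum_range, sum_Icc_one_eq_sum_range, sum_Icc_one_eq_sum_range, htop,
    hbot, Finset.mul_sum, Finset.mul_sum, ← Finset.sum_add_distrib]
  refine Finset.sum_congr rfl fun l _ => ?_
  rw [H_succ hi]
  ring

theorem XOrdered.mono (h : B.XOrdered Q) {i' : ℕ} (hi : 1 ≤ i) (hii : i ≤ i')
    (hi' : i' ≤ B.r) : B.Xlast Q i ≤ B.Xlast Q i' := by
  induction i', hii using Nat.le_induction with
  | base => exact le_rfl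
  | succ i' hii ih => exact (ih (by omega)).trans (h.2 i' (by omega) (by omega))

theorem XOrdered.one_le (h : B.XOrdered Q) (hi : 1 ≤ i) (hir : i ≤ B.r) : 1 ≤ B.Xlast Q i :=
  h.1.trans (h.mono le_rfl hi hir)

theorem C_succ_r (j : ℤ) : B.C Q (B.r + 1) j = if j = 0 then 1 else 0 := by
  rw [C, if_pos (by omega)]

theorem C_zero (hi : i ≤ B.r + 1) : B.C Q i 0 = B.H Q 0 i := by
  rw [H_zero]
  obtain rfl | hi := hi.eq_or_lt
  · simp [C_succ_r]
  · rw [C, if_neg (by omega), if_pos rfl, if_pos rfl]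
    split_ifs with hir
    · simp [hir]
    · rfl

theorem C_eq_sum (hi : i ≤ B.r + 1) {j : ℤ} (hj : 1 ≤ j) (hjX : i ≤ B.r → j < B.Xlast Q i) :
    B.C Q i j = ∑ l ∈ Finset.Icc 1 (B.r + 1 - i), F l j * B.H Q l i := by
  obtain rfl | hi := hi.eq_or_lt
  · rw [C_succ_r, if_neg (by omega), Nat.sub_self, Finset.Icc_eq_empty (by omega),
      Finset.sum_empty]
  obtain rfl | hir := (Nat.lt_succ_iff.1 hi).eq_or_lt
  · rw [C, if_neg (by omega), if_pos rfl, if_neg (by omega), if_pos (hjX le_rfl),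
      sum_F_mul_H_eq le_rfl, H_zero]
    simp
  · have hlen : B.r - i + 1 = B.r + 1 - i := by omega
    rw [C, if_neg (by omega), if_neg hir.ne, if_neg (by omega), if_pos (hjX hir.le), hlen]

theorem C_eq_of_lt_Xlast (h : B.XOrdered Q) (hi : 1 ≤ i) (hir : i ≤ B.r) {j : ℤ} (hj : 0 ≤ j)
    (hjX : j < B.Xlast Q i) :
    B.C Q i j = (B.Da Q i + j * B.a i) * B.C Q (i + 1) j
      + B.a i * ∑ l ∈ Finset.Ico 0 j, B.C Q (i + 1) l := by
  have hX (hir' : i + 1 ≤ B.r) : j < B.Xlast Q (i + 1) := hjX.trans_le (h.2 i hi hir')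
  have hlen : B.r + 1 - (i + 1) = B.r - i := by omega
  obtain rfl | hj := hj.eq_or_lt
  · rw [C_zero (by omega), C_zero (by omega), H_zero, H_zero,
      ← Finset.insert_Icc_add_one_left_eq_Icc hir, Finset.prod_insert (by simp)]
    simp
  have hsum : ∑ x ∈ Finset.Icc 1 (j - 1), B.C Q (i + 1) x =
      ∑ l ∈ Finset.Icc 1 (B.r - i), (∑ x ∈ Finset.Icc 1 (j - 1), F l x) * B.H Q l (i + 1) := by
    simp only [Finset.sum_mul]
    rw [Finset.sum_comm]
    refine Finset.sum_congr rfl fun x hx => ?_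
    rw [Finset.mem_Icc] at hx
    rw [C_eq_sum (by omega) hx.1 fun hir' => by linarith [hX hir', hx.2], hlen]
  have hF : ∑ l ∈ Finset.Icc 1 (B.r - i), F (l + 1) j * B.H Q l (i + 1) =
      ∑ l ∈ Finset.Icc 1 (B.r - i), (∑ x ∈ Finset.Icc 1 (j - 1), F l x) * B.H Q l (i + 1)
        + j * ∑ l ∈ Finset.Icc 1 (B.r - i), F l j * B.H Q l (i + 1) := by
    rw [Finset.mul_sum, ← Finset.sum_add_distrib]
    refine Finset.sum_congr rfl fun l hl => ?_
    rw [F_succ (Finset.mem_Icc.1 hl).1 hj]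
    ring
  rw [C_eq_sum (by omega) hj fun _ => hjX, C_eq_sum (by omega) hj hX, hlen, sum_F_mul_H_eq hir,
    hF, sum_Ico_zero_eq hj, C_zero (by omega), hsum]
  ring

theorem C_Xlast (h : B.XOrdered Q) (hi : 1 ≤ i) (hir : i ≤ B.r) :
    B.C Q i (B.Xlast Q i) =
      B.a' Q i * (∑ l ∈ Finset.Ico 0 (B.Xlast Q i), B.C Q (i + 1) l)
        + (Q - B.NMax i) * B.C Q (i + 1) (B.Xlast Q i) := by
  have hX := h.one_le hi hir
  obtain rfl | hir := hir.eq_or_lt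
  · have hmem : (0 : ℤ) ∈ Finset.Ico 0 (B.Xlast Q B.r) := Finset.mem_Ico.2 ⟨le_rfl, by omega⟩
    simp only [C_succ_r, Finset.sum_ite_eq']
    rw [C, if_neg (by omega), if_pos rfl, if_neg (by omega), if_neg (by omega), if_pos rfl,
      if_pos hmem, if_neg (by omega), mul_one, mul_zero, add_zero]
  · rw [C, if_neg (by omega), if_neg (by omega), if_neg (by omega), if_neg (by omega), if_pos rfl]

theorem C_of_Xlast_lt (h : B.XOrdered Q) (hi : 1 ≤ i) (hir : i ≤ B.r) {j : ℤ}
    (hj : B.Xlast Q i < j) : B.C Q i j = (Q - B.NMax i) * B.C Q (i + 1) j := by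
  have hX := h.one_le hi hir
  obtain rfl | hir := hir.eq_or_lt
  · rw [C_succ_r, C, if_neg (by omega), if_pos rfl, if_neg (by omega), if_neg (by omega),
      if_neg (by omega), if_neg (by omega), mul_zero]
  · rw [C, if_neg (by omega), if_neg (by omega), if_neg (by omega), if_neg (by omega),
      if_neg (by omega)]

theorem sum_C_mul_integral_succ (h : B.XOrdered Q) (hi : 1 ≤ i) (hir : i ≤ B.r) :
    ∑ j ∈ Finset.Icc 0 (B.Xlast Q B.r), B.C Q (i + 1) j * B.integral Q (i + 1) j =
      ∑ j ∈ Finset.Icc 0 (B.Xlast Q B.r), B.C Q i j * B.integral Q i j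
        + B.Kconst Q i * ∑ j ∈ Finset.Icc 0 (B.Xlast Q B.r), B.C Q (i + 1) j :=
  sum_mul_eq_sum_transpose_mul (zero_le_one.trans (h.one_le hi hir)) (h.mono hi hir le_rfl)
    (fun _ hj => integral_succ_of_lt hi hj) (fun _ hj => integral_succ_of_le hi hj)
    (fun _ hj hjX => C_eq_of_lt_Xlast h hi hir hj hjX) (C_Xlast h hi hir)
    (fun _ hj => C_of_Xlast_lt h hi hir hj)

theorem hkFormula_eq_sum (h : B.XOrdered Q) (hr : 1 ≤ B.r) :
    B.hkFormula Q = ∑ j ∈ Finset.Icc 0 (B.Xlast Q B.r), B.C Q 1 j * B.integral Q 1 j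
      + ∑ l ∈ Finset.Icc 1 B.r,
          B.Kconst Q l * ∑ j ∈ Finset.Icc 0 (B.Xlast Q B.r), B.C Q (l + 1) j := by
  have hX := h.one_le hr le_rfl
  have hlast : B.hkFormula Q = ∑ j ∈ Finset.Icc 0 (B.Xlast Q B.r),
      B.C Q (B.r + 1) j * B.integral Q (B.r + 1) j := by
    rw [hkFormula_eq_integral hr (by omega)]
    have hmem : (0 : ℤ) ∈ Finset.Icc 0 (B.Xlast Q B.r) := Finset.mem_Icc.2 ⟨le_rfl, by omega⟩
    simp only [C_succ_r, ite_mul, one_mul, zero_mul, Finset.sum_ite_eq', if_pos hmem]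
  have htelescope : ∀ i ≤ B.r,
      ∑ j ∈ Finset.Icc 0 (B.Xlast Q B.r), B.C Q (i + 1) j * B.integral Q (i + 1) j =
        ∑ j ∈ Finset.Icc 0 (B.Xlast Q B.r), B.C Q 1 j * B.integral Q 1 j
        + ∑ l ∈ Finset.Icc 1 i,
            B.Kconst Q l * ∑ j ∈ Finset.Icc 0 (B.Xlast Q B.r), B.C Q (l + 1) j := by
    intro i hir
    induction i with
    | zero => simp
    | succ i ih =>
      rw [sum_C_mul_integral_succ h (by omega) hir, ih (by omega),
        Finset.sum_Icc_succ_top (by omega), add_assoc]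
  exact hlast.trans (htelescope B.r le_rfl)

theorem sum_C_eq (h : B.XOrdered Q) (hi : 1 ≤ i) (hir : i ≤ B.r) :
    ∑ j ∈ Finset.Icc 0 (B.Xlast Q B.r), B.C Q i j =
      B.C Q i 0
        + ∑ l ∈ Finset.Icc 1 (B.r + 1 - i), B.H Q l i *
            ∑ j ∈ Finset.Icc 1 (B.Xlast Q i - 1), F l j
        + ∑ j ∈ Finset.Icc (B.Xlast Q i) (B.Xlast Q B.r), B.C Q i j := by
  have hX := h.one_le hi hir
  have hXr := h.mono hi hir le_rfl
  have hmiddle : ∑ j ∈ Finset.Icc 1 (B.Xlast Q i - 1), B.C Q i j =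
      ∑ l ∈ Finset.Icc 1 (B.r + 1 - i), B.H Q l i *
        ∑ j ∈ Finset.Icc 1 (B.Xlast Q i - 1), F l j := by
    simp only [Finset.mul_sum]
    rw [Finset.sum_comm]
    refine Finset.sum_congr rfl fun j hj => ?_
    rw [Finset.mem_Icc] at hj
    simp only [C_eq_sum (by omega) hj.1 fun _ => Int.lt_of_le_sub_one hj.2, mul_comm]
  rw [sum_Icc_eq_sum_Ico_add_sum_Ioc (by omega) hXr, sum_Ico_zero_eq hX, hmiddle, add_assoc,
    ← Finset.sum_insert Finset.left_notMem_Ioc, Finset.Ioc_insert_left hXr]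

theorem sum_Kconst_mul_sum_C_eq (h : B.XOrdered Q) :
    ∑ l ∈ Finset.Ico 1 B.r,
        B.Kconst Q l * ∑ j ∈ Finset.Icc 0 (B.Xlast Q B.r), B.C Q (l + 1) j =
      ∑ c ∈ Finset.Icc 1 (B.r - 1),
        ((B.NMax (B.r - c) - B.NMin (B.r - c)) * B.GN Q (B.r - c)
          + B.NMin (B.r - c) * (Q : ℤ) ^ (B.s + B.t + B.r - c - 1)) *
        (B.C Q (B.r - c + 1) 0
          + ∑ l ∈ Finset.Icc 1 c, B.H Q l (B.r - c + 1) *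
              ∑ j ∈ Finset.Icc 1 (B.Xlast Q (B.r - c + 1) - 1), F l j
          + ∑ j ∈ Finset.Icc (B.Xlast Q (B.r - c + 1)) (B.Xlast Q B.r),
              B.C Q (B.r - c + 1) j) := by
  refine Finset.sum_nbij' (fun l => B.r - l) (fun c => B.r - c) ?_ ?_ ?_ ?_ ?_
  all_goals
    intro l hl
    simp only [Finset.mem_Ico, Finset.mem_Icc] at hl ⊢
  iterate 4 omega
  have hsub : B.r - (B.r - l) = l := by omega
  have hlen : B.r + 1 - (l + 1) = B.r - l := by omega
  have hexp : B.s + B.t + B.r - (B.r - l) - 1 = B.s + B.t + l - 1 := by omega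
  rw [hsub, hexp, sum_C_eq h (by omega) (by omega), hlen, Kconst]

theorem hkFormula_eq_hkExpanded (h : B.XOrdered Q) (hr : 1 ≤ B.r) :
    B.hkFormula Q = B.hkExpanded Q := by
  have hX := h.one_le le_rfl hr
  have hXr := h.one_le hr le_rfl
  have htail : ∑ j ∈ Finset.Ioc (B.Xlast Q 1) (B.Xlast Q B.r), B.C Q 1 j * B.integral Q 1 j =
      (Q - B.NMax 1) *
        ∑ j ∈ Finset.Icc (B.Xlast Q 1 + 1) (B.Xlast Q B.r), B.C Q 2 j * B.integral Q 1 j := by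
    rw [Finset.Icc_add_one_left_eq_Ioc, Finset.mul_sum]
    refine Finset.sum_congr rfl fun j hj => ?_
    rw [C_of_Xlast_lt h le_rfl hr (Finset.mem_Ioc.1 hj).1, mul_assoc]
  have hlast : ∑ j ∈ Finset.Icc 0 (B.Xlast Q B.r), B.C Q (B.r + 1) j = 1 := by
    have hmem : (0 : ℤ) ∈ Finset.Icc 0 (B.Xlast Q B.r) := Finset.mem_Icc.2 ⟨le_rfl, by omega⟩
    simp only [C_succ_r, Finset.sum_ite_eq', if_pos hmem]
  rw [hkFormula_eq_sum h hr, ← Finset.Ico_add_one_right_eq_Icc 1, Finset.sum_Ico_succ_top hr,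
    hlast, sum_Kconst_mul_sum_C_eq h,
    sum_Icc_eq_sum_Ico_add_sum_Ioc (by omega) (h.mono le_rfl hr le_rfl), htail,
    C_Xlast h le_rfl hr, hkExpanded, Kconst]
  ring

end Expansion

/-! ### The closed form of `Φ` -/

section ClosedForm

theorem frakS_eq (M : ℤ) (l : ℕ) :
    B.frakS Q M l = (Q : ℤ) ^ (B.t + l)
      - ((Q : ℤ) ^ B.t - B.frakS Q M 0) * ∏ i ∈ Finset.Icc 1 l, ((Q : ℤ) - B.ZMin i) := by
  induction l with
  | zero => simp
  | succ l ih =>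
    rw [frakS.eq_2, ih, Finset.prod_Icc_succ_top (by omega)]
    ring

theorem frakS_zero_eq_of_simple {M : ℤ} (ht : 1 ≤ B.t) (h : B.Simple Q M) :
    B.frakS Q M 0 = ∏ q ∈ Finset.Icc 1 B.t, ((Q : ℤ) - M * B.ΔP q)
      + ∑ l ∈ Finset.Icc 2 B.t, (-1) ^ l * B.mixedSum Q M l * (Q : ℤ) ^ (B.t - l) := by
  have hP_one : B.hP Q M 1 = 0 := by
    have := (h 1 le_rfl ht).1
    rw [hP, if_neg (by omega)]
  have hprod_hP : ∏ x ∈ Finset.Icc 1 B.t, B.hP Q M x = 0 :=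
    Finset.prod_eq_zero (Finset.mem_Icc.2 ⟨le_rfl, ht⟩) hP_one
  have hminc : ∀ q ∈ Finset.Icc 1 B.t, (Q : ℤ) - M * B.ΔP q = Q - B.minc Q M q := by
    intro q hq
    rw [Finset.mem_Icc] at hq
    have := (h q hq.1 hq.2).2
    rw [minc] at this ⊢
    omega
  have hexpand := prod_const_sub_add_eq (Finset.Icc 1 B.t) (Q : ℤ) (B.minc Q M) B.PMin
  rw [Nat.card_Icc, Nat.add_sub_cancel] at hexpand
  simp only [frakS_zero_eq, Finset.Ico_add_one_right_eq_Icc, hprod_hP, sub_zero, mixedSum,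
    Finset.prod_congr rfl hminc, sub_sub, add_comm (B.PMin _), hexpand]
  ring

theorem Φ_eq_ΦClosed {M : ℤ} (ht : 1 ≤ B.t) (h : B.Simple Q M) : B.Φ Q M = B.ΦClosed Q M := by
  have hexpand := prod_const_sub_eq_sum_powersetCard (Finset.Icc 1 B.s) (Q : ℤ) B.ZMin
  rw [Nat.card_Icc, Nat.add_sub_cancel] at hexpand
  have hZ : ∑ c ∈ Finset.Icc 1 B.s, (-1) ^ (c + 1) * (Q : ℤ) ^ (B.t + B.s - c) *
      ∑ T ∈ (Finset.Icc 1 B.s).powersetCard c, ∏ i ∈ T, B.ZMin i =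
      (Q : ℤ) ^ B.t * ((Q : ℤ) ^ B.s - ∏ i ∈ Finset.Icc 1 B.s, ((Q : ℤ) - B.ZMin i)) := by
    rw [hexpand, sub_add_cancel_left, ← Finset.sum_neg_distrib, Finset.mul_sum]
    refine Finset.sum_congr rfl fun c hc => ?_
    rw [Nat.add_sub_assoc (Finset.mem_Icc.1 hc).2, pow_add, pow_succ]
    ring
  rw [Φ, frakS_eq, frakS_zero_eq_of_simple ht h, ΦClosed, hZ]
  ring

end ClosedForm

/-! ### The range of validity -/

section Range

theorem a_le_a_r (hΔ : Monotone B.Δ) (hi : 1 ≤ i) (hir : i ≤ B.r) : B.a i ≤ B.a B.r := by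
  have hm := B.r_add_s_add_t
  rw [a, a, diff, diff, dif_pos (by omega), dif_pos (by omega), neg_le_neg_iff]
  exact hΔ (Fin.mk_le_mk.2 (by omega))

theorem maxSteps_r_le_maxSteps (hΔ : Monotone B.Δ) (hi : 1 ≤ i) (hir : i ≤ B.r)
    (hb : B.a i = B.a B.r → B.b i ≤ B.b B.r) (hQ : 1 + B.b i + B.a i * B.b i ≤ Q) :
    B.maxSteps Q B.r ≤ B.maxSteps Q i :=
  sub_ediv_le_sub_ediv (a_pos hΔ hi hir) (a_le_a_r hΔ hi hir) B.b_nonneg B.b_nonneg hb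
    (by linarith)

theorem xOrdered_of_two_le_maxSteps (hΔ : Monotone B.Δ) (hr : 1 ≤ B.r) (h : B.Admissible Q)
    (htwo : 2 ≤ B.maxSteps Q B.r) : B.XOrdered Q := by
  have hX : ∀ i, 1 ≤ i → i ≤ B.r → B.Xlast Q i = B.maxSteps Q B.r - 1 := by
    intro i hi hir
    have := h.maxSteps_le hΔ hi hir
    rw [Xlast_eq hΔ hi hir, kLast_eq hΔ hi hir]
    omega
  refine ⟨?_, fun i hi hir => ?_⟩
  · rw [hX 1 le_rfl hr]
    omega
  · rw [hX i hi hir.le, hX (i + 1) (by omega) hir]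

theorem eventually_admissible (hΔ : Monotone B.Δ)
    (hb : ∀ i, 1 ≤ i → i ≤ B.r → B.a i = B.a B.r → B.b i ≤ B.b B.r) :
    ∀ᶠ Q in Filter.atTop, B.Admissible Q := by
  have hlarge (z : ℤ) : ∀ᶠ Q : ℕ in Filter.atTop, z ≤ Q :=
    tendsto_natCast_atTop_atTop.eventually_ge_atTop z
  have hQ : ∀ᶠ Q : ℕ in Filter.atTop, ∀ i ∈ Finset.Icc 1 B.r, 1 + B.b i + B.a i * B.b i ≤ Q :=
    (Filter.eventually_all_finset _).2 fun i _ => hlarge _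
  filter_upwards [Filter.eventually_all.2 fun i => Filter.eventually_gt_atTop (B.e₂ i),
    Filter.eventually_all.2 fun i => Filter.eventually_ge_atTop (B.e₁ i), hQ] with Q he₂ he₁ hQ
  refine ⟨he₂, he₁, fun i hi hir => ?_⟩
  rw [← (maxSteps_eq_and_E_eq (a_pos hΔ hi hir)).1,
    ← (maxSteps_eq_and_E_eq (a_pos hΔ (hi.trans hir) le_rfl)).1]
  exact maxSteps_r_le_maxSteps hΔ hi hir (hb i hi hir) (hQ i (Finset.mem_Icc.2 ⟨hi, hir⟩))

theorem eventually_admissible_and_xOrdered (hΔ : Monotone B.Δ) (hr : 1 ≤ B.r)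
    (hb : ∀ i, 1 ≤ i → i ≤ B.r → B.a i = B.a B.r → B.b i ≤ B.b B.r) :
    ∀ᶠ Q in Filter.atTop, B.Admissible Q ∧ B.XOrdered Q := by
  filter_upwards [eventually_admissible hΔ hb,
    tendsto_natCast_atTop_atTop.eventually_ge_atTop (1 + B.b B.r + 2 * B.a B.r)] with Q h hQ
  refine ⟨h, xOrdered_of_two_le_maxSteps hΔ hr h ?_⟩
  rw [maxSteps, Int.le_ediv_iff_mul_le (a_pos hΔ hr le_rfl)]
  linarith

end Range

end Exponents

end BinomialHK

theorem mainTheorem2_general {k : Type*} [Field k] {m : ℕ} (B : BinomialHK.Exponents m)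
    (c₂ c₁ : k) (hc₂ : c₂ ≠ 0) (hc₁ : c₁ ≠ 0) (hΔ : Monotone B.Δ) (hr : 1 ≤ B.r) :
    (∀ Q : ℕ, B.Admissible Q →
      ∃ L : ℕ, BinomialHK.hkLength (B.poly c₂ c₁) Q = (L : ℕ∞) ∧
        (L : ℤ) = B.hkFormula Q ∧ (B.XOrdered Q → (L : ℤ) = B.hkExpanded Q)) ∧
    (∀ Q : ℕ, ∀ M : ℤ, 1 ≤ B.t → B.Simple Q M → B.Φ Q M = B.ΦClosed Q M) ∧
    ((∀ i : ℕ, 1 ≤ i → i ≤ B.r → B.a i = B.a B.r → B.b i ≤ B.b B.r) →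
      ∀ᶠ Q : ℕ in Filter.atTop, B.Admissible Q ∧ B.XOrdered Q) := by
  refine ⟨fun Q h => ?_, fun Q M ht h => BinomialHK.Exponents.Φ_eq_ΦClosed ht h,
    BinomialHK.Exponents.eventually_admissible_and_xOrdered hΔ hr⟩
  obtain ⟨L, hL, hLformula⟩ := BinomialHK.Exponents.exists_hkLength_eq hΔ hc₂ hc₁ hr h
  exact ⟨L, hL, hLformula, fun hX =>
    hLformula.trans (BinomialHK.Exponents.hkFormula_eq_hkExpanded hX hr)⟩

theorem mainTheorem2 {k : Type*} [Field k] (p : ℕ) [Fact p.Prime] [CharP k p]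
    {m : ℕ} (B : BinomialHK.Exponents m) (c₂ c₁ : k) (hc₂ : c₂ ≠ 0) (hc₁ : c₁ ≠ 0)
    (hΔ : Monotone B.Δ) (hr : 1 ≤ B.r) :
    (∀ n : ℕ, B.Admissible (p ^ n) →
      ∃ L : ℕ, BinomialHK.hkLength (B.poly c₂ c₁) (p ^ n) = (L : ℕ∞) ∧
        (L : ℤ) = B.hkFormula (p ^ n) ∧
        (B.XOrdered (p ^ n) → (L : ℤ) = B.hkExpanded (p ^ n))) ∧
    (∀ n : ℕ, ∀ M : ℤ, 1 ≤ B.t → B.Simple (p ^ n) M →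
      B.Φ (p ^ n) M = B.ΦClosed (p ^ n) M) ∧
    ((∀ i : ℕ, 1 ≤ i → i ≤ B.r → B.a i = B.a B.r → B.b i ≤ B.b B.r) →
      ∀ᶠ n : ℕ in Filter.atTop, B.Admissible (p ^ n) ∧ B.XOrdered (p ^ n)) := by
  obtain ⟨hlength, hΦ, hrange⟩ := mainTheorem2_general B c₂ c₁ hc₂ hc₁ hΔ hr
  exact ⟨fun n => hlength _, fun n => hΦ _, fun hb => (tendsto_pow_atTop_atTop_of_one_lt
    (Fact.out : p.Prime).one_lt).eventually (hrange hb)⟩
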